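/- Let $m,n\ge 1$, let $\Sigma_p\subset\mathbb R^m$ and $\Sigma_q\subset\mathbb R^n$ be the simplices of probability vectors, with unit vectors $e^p_i$, $e^q_j$ as vertices, and let $\hat\Sigma_p,\hat\Sigma_q$ be the hyperplanes of vectors with coordinate sum $1$. For a real $m\times n$ matrix $M$ put $BR_p(q)=\operatorname{argmax}_{p\in\Sigma_p}p'Mq$ and $BR_q(p)=\operatorname{argmin}_{q\in\Sigma_q}p'Mq$ (set-valued, for $q\in\mathbb R^n$, $p\in\mathbb R^m$). Let $(\bar p,\bar q)\in\Sigma_p\times\Sigma_q$ be a completely mixed Nash equilibrium: $\bar p\in BR_p(\bar q)$, $\bar q\in BR_q(\bar p)$, and all components of $\bar p,\bar q$ are strictly positive. Let $\alpha\in\mathbb R$, let $X$ be an $m\times m$ and $Y$ an $n\times n$ real matrix with $$MY=X'M,\qquad Xp+\alpha\bar p\in\hat\Sigma_p\ (p\in\Sigma_p),\qquad Yq+\alpha\bar q\in\hat\Sigma_q\ (q\in\Sigma_q).$$ Assume: (T1) every $r\times r$ minor of $M$ with $r\ge2$ is non-zero; (T3) for all nonempty $J\subset\{1,\dots,n\}$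 and $I\subset\{1,\dots,m\}$, let $Z_p(J)$ be the set of $p\in\Sigma_p$ with $BR_q(p)=\operatorname{conv}\{e^q_j:j\in J\}$ and $Z_q(I)$ the set of $q\in\Sigma_q$ with $BR_p(q)=\operatorname{conv}\{e^p_i:i\in I\}$. Then the affine spans of $Z_p(J)$ and of $\{Xe^p_i+\alpha\bar p:i\in I\}$ are in general position in $\hat\Sigma_p$, and the affine spans of $Z_q(I)$ and of $\{Ye^q_j+\alpha\bar q:j\in J\}$ are in general position in $\hat\Sigma_q$. (Two affine subspaces are in general position in $A$ if they are disjoint or together span $A$.) Consider on $\hat\Sigma_p\times\hat\Sigma_q$ the differential inclusion $$\frac{dp}{dt}\in X\,BR_p(q)+\alpha\bar p-p,\qquad \frac{dq}{dt}\in Y\,BR_q(p)+\alpha\bar q-q,\qquad(*)$$ whose solutions on an interval are the curves, absolutely continuous on its compact subintervals, that satisfy $(*)$ at almost every time. By a unique solution through $z$ we mean: there is a solution $\gamma\colon\mathbb R\to\mathbb R^m\times\mathbb R^n$ with $\gamma(0)=z$, and every solution on an interval containing $0$ that equals $z$ at time $0$ coincides with $\gamma$ on that interval. By a continuous flow of $(*)$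 on a set $S$ we mean a jointly continuous action of the group $\mathbb R$ on $S$ all of whose orbits $t\mapsto\phi_t(z)$ are solutions of $(*)$. Then: (a) If $m=n$, there is a unique solution through each $(p,q)\in\hat\Sigma_p\times\hat\Sigma_q$ with $(p,q)\ne(\bar p,\bar q)$, and $(*)$ has a continuous flow on $\hat\Sigma_p\times\hat\Sigma_q$. (b) For arbitrary $m,n$, let $N$ be the set of $(p,q)\in\hat\Sigma_p\times\hat\Sigma_q$ with $BR_p(q)=\Sigma_p$ and $BR_q(p)=\Sigma_q$ (its points in $\Sigma_p\times\Sigma_q$ are precisely the Nash equilibria). There is a unique solution through each $(p,q)\in(\hat\Sigma_p\times\hat\Sigma_q)\setminus N$, and $(*)$ has a continuous flow on $(\hat\Sigma_p\times\hat\Sigma_q)\setminus N$. -/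

import Mathlib

open Matrix MeasureTheory

namespace ZeroSumGame

/-- The hyperplane of vectors with coordinate sum one; it contains the simplex of
probability vectors. -/
def hyperplane (k : ℕ) : AffineSubspace ℝ (Fin k → ℝ) where
  carrier := {x | ∑ i, x i = 1}
  smul_vsub_vadd_mem' := by
    intro c x y z hx hy hz
    simp only [Set.mem_ofPred_eq] at hx hy hz ⊢
    simp [Finset.sum_add_distrib, ← Finset.mul_sum, Finset.sum_sub_distrib, hx, hy, hz]

/-- The phase space: the product of the two hyperplanes containing the simplices. -/
def phaseSpace (m n : ℕ) : Set ((Fin m → ℝ) × (Fin n → ℝ)) :=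
  {z | z.1 ∈ hyperplane m ∧ z.2 ∈ hyperplane n}

/-- Best responses of the first player: maximizers of `p' M q` over probability vectors `p`. -/
def brP {m n : ℕ} (M : Matrix (Fin m) (Fin n) ℝ) (q : Fin n → ℝ) : Set (Fin m → ℝ) :=
  {p ∈ stdSimplex ℝ (Fin m) |
    ∀ p' ∈ stdSimplex ℝ (Fin m), p' ⬝ᵥ (M *ᵥ q) ≤ p ⬝ᵥ (M *ᵥ q)}

/-- Best responses of the second player: minimizers of `p' M q` over probability vectors `q`. -/
def brQ {m n : ℕ} (M : Matrix (Fin m) (Fin n) ℝ) (p : Fin m → ℝ) : Set (Fin n → ℝ) :=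
  {q ∈ stdSimplex ℝ (Fin n) |
    ∀ q' ∈ stdSimplex ℝ (Fin n), p ⬝ᵥ (M *ᵥ q) ≤ p ⬝ᵥ (M *ᵥ q')}

/-- `(p, q)` is a Nash equilibrium. -/
def IsNash {m n : ℕ} (M : Matrix (Fin m) (Fin n) ℝ) (p : Fin m → ℝ) (q : Fin n → ℝ) : Prop :=
  p ∈ brP M q ∧ q ∈ brQ M p

/-- `(p, q)` is a Nash equilibrium all of whose components are strictly positive. -/
def IsCompletelyMixedNash {m n : ℕ} (M : Matrix (Fin m) (Fin n) ℝ)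
    (p : Fin m → ℝ) (q : Fin n → ℝ) : Prop :=
  IsNash M p q ∧ (∀ i, 0 < p i) ∧ (∀ j, 0 < q j)

/-- Every mixed strategy of each player is a best response. -/
def IsIndifferent {m n : ℕ} (M : Matrix (Fin m) (Fin n) ℝ)
    (z : (Fin m → ℝ) × (Fin n → ℝ)) : Prop :=
  brP M z.2 = stdSimplex ℝ (Fin m) ∧ brQ M z.1 = stdSimplex ℝ (Fin n)

/-- First transversality assumption: every `r × r` minor with `r ≥ 2` is non-zero. -/
def FirstTransversality {m n : ℕ} (M : Matrix (Fin m) (Fin n) ℝ) : Prop :=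
  ∀ r : ℕ, 2 ≤ r → ∀ (f : Fin r ↪o Fin m) (g : Fin r ↪o Fin n), (M.submatrix f g).det ≠ 0

/-- Two affine subspaces are in general position with respect to an ambient affine space `A`:
they are disjoint or together span `A`. -/
def GeneralPosition {k : ℕ} (A H₁ H₂ : AffineSubspace ℝ (Fin k → ℝ)) : Prop :=
  H₁ ⊓ H₂ = ⊥ ∨ H₁ ⊔ H₂ = A

/-- The face of the simplex spanned by the unit vectors with index in `I`. -/
def face {k : ℕ} (I : Finset (Fin k)) : Set (Fin k → ℝ) :=
  convexHull ℝ ((fun i => Pi.single i (1 : ℝ)) '' (I : Set (Fin k)))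

/-- The indifference set of probability vectors `p` whose best responses are exactly the
face with index set `J`. -/
def indiffP {m n : ℕ} (M : Matrix (Fin m) (Fin n) ℝ) (J : Finset (Fin n)) : Set (Fin m → ℝ) :=
  {p ∈ stdSimplex ℝ (Fin m) | brQ M p = face J}

/-- The indifference set of probability vectors `q` whose best responses are exactly the
face with index set `I`. -/
def indiffQ {m n : ℕ} (M : Matrix (Fin m) (Fin n) ℝ) (I : Finset (Fin m)) : Set (Fin n → ℝ) :=
  {q ∈ stdSimplex ℝ (Fin n) | brP M q = face I}

/-- The affine space spanned by the points `X eᵢ + α c` with `i ∈ I`. -/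
def targetSpan {k : ℕ} (X : Matrix (Fin k) (Fin k) ℝ) (α : ℝ) (c : Fin k → ℝ)
    (I : Finset (Fin k)) : AffineSubspace ℝ (Fin k → ℝ) :=
  affineSpan ℝ ((fun i => X *ᵥ (Pi.single i (1 : ℝ)) + α • c) '' (I : Set (Fin k)))

/-- Third transversality assumption: the affine spans of the indifference sets and of the
targets are in general position in the hyperplanes containing the simplices. -/
def ThirdTransversality {m n : ℕ} (M : Matrix (Fin m) (Fin n) ℝ)
    (X : Matrix (Fin m) (Fin m) ℝ) (Y : Matrix (Fin n) (Fin n) ℝ) (α : ℝ)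
    (pbar : Fin m → ℝ) (qbar : Fin n → ℝ) : Prop :=
  ∀ (J : Finset (Fin n)) (I : Finset (Fin m)), J.Nonempty → I.Nonempty →
    GeneralPosition (hyperplane m) (affineSpan ℝ (indiffP M J)) (targetSpan X α pbar I) ∧
    GeneralPosition (hyperplane n) (affineSpan ℝ (indiffQ M I)) (targetSpan Y α qbar J)

/-- The set-valued right-hand side `(X BR_p(q) + α p̄ - p, Y BR_q(p) + α q̄ - q)`. -/
def vectorField {m n : ℕ} (M : Matrix (Fin m) (Fin n) ℝ)
    (X : Matrix (Fin m) (Fin m) ℝ) (Y : Matrix (Fin n) (Fin n) ℝ) (α : ℝ)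
    (pbar : Fin m → ℝ) (qbar : Fin n → ℝ) (z : (Fin m → ℝ) × (Fin n → ℝ)) :
    Set ((Fin m → ℝ) × (Fin n → ℝ)) :=
  {v | ∃ u ∈ brP M z.2, ∃ w ∈ brQ M z.1,
    v = (X *ᵥ u + α • pbar - z.1, Y *ᵥ w + α • qbar - z.2)}

/-- `γ` solves the inclusion `dz/dt ∈ F z` on the interval `I`: it is absolutely continuous on
compact subintervals of `I` and satisfies the inclusion at almost every time in `I`. -/
def IsSolutionOn {E : Type*} [NormedAddCommGroup E] [NormedSpace ℝ E] (F : E → Set E)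
    (I : Set ℝ) (γ : ℝ → E) : Prop :=
  (∀ a ∈ I, ∀ b ∈ I, AbsolutelyContinuousOnInterval γ a b) ∧
    ∀ᵐ t ∂(volume : Measure ℝ), t ∈ I → ∃ v ∈ F (γ t), HasDerivAt γ v t

/-- Through `z` there is a solution defined for all times, and every solution through `z` on
any interval around time zero coincides with it there. -/
def HasUniqueSolution {E : Type*} [NormedAddCommGroup E] [NormedSpace ℝ E] (F : E → Set E)
    (z : E) : Prop :=
  ∃ γ : ℝ → E, IsSolutionOn F Set.univ γ ∧ γ 0 = z ∧
    ∀ I : Set ℝ, I.OrdConnected → (0 : ℝ) ∈ I →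
      ∀ δ : ℝ → E, IsSolutionOn F I δ → δ 0 = z → Set.EqOn δ γ I

/-- The solutions of the inclusion form a continuous flow on `S`: there is a jointly continuous
action of `ℝ` on `S` all of whose orbits are solutions. -/
def GeneratesFlow {E : Type*} [NormedAddCommGroup E] [NormedSpace ℝ E] (F : E → Set E)
    (S : Set E) : Prop :=
  ∃ φ : Flow ℝ S, ∀ z : S, IsSolutionOn F Set.univ (fun t => (φ t z : E))

end ZeroSumGame

/-! Let `x` be the displacement from the equilibrium. Substituting `e^t x` for `x` and `e^t` for
time removes the term `-x` and leaves an inclusion with right-hand side `G` (`velocities`). Best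
responses depend only on which payoffs are maximal, so `G` is unchanged by positive scaling and `G y
⊆ G x` for `y` near `x`. As `G x` is closed and convex, increments of a solution over short times
are the elapsed clock time times a velocity in `G` of the base point
(`isSecantSolution_of_isSolutionOn`).

The conserved quantity is the gap `max (M x₂) + max (-Mᵀ x₁)`. Because `M Y = Xᵀ M`, the bilinear
terms cancel in the lower bound by current best responses, so the gap is not smaller at the end of
any secant, forward or backward (`IsEqualizing.gap_le`). Every time is thus a local minimum of the
gap, which is therefore constant.

Conservation makes the chosen pair of best responses an equilibrium of the zero-sum game with
payoffs `r M Y` (`r` the clock increment) on the two maximal faces (`IsEqualizing.mul_mulVec_le`).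
Transversality makes this local equilibrium unique wherever the gap is nonzero
(`eq_or_full_support`, `IsEqualizing.velocity_unique`). Two solutions through a point thus have the
same secants, and agree. The gap vanishes exactly on `N`, which for `m = n` is the equilibrium
alone.

Existence comes from Euler polygons and ultrafilter limits; the same limits together with uniqueness
give continuity in the initial value. -/

open Filter Topology Set

namespace ZeroSumGame

/-! ### Secant solutions, conservation, and limits of approximate solutions -/

section Inclusion

variable {E : Type*} [NormedAddCommGroup E] [NormedSpace ℝ E]

/-- A set-valued map with nonempty closed convex values inside a fixed ball, whose values near a
point are contained in the value at that point. -/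
structure IsLocallyMaximal (G : E → Set E) (K : ℝ) : Prop where
  nonempty : ∀ x, (G x).Nonempty
  convex : ∀ x, Convex ℝ (G x)
  isClosed : ∀ x, IsClosed (G x)
  subset_closedBall : ∀ x, G x ⊆ Metric.closedBall 0 K
  eventually_subset : ∀ x, ∀ᶠ y in 𝓝 x, G y ⊆ G x

/-- A continuous function `h` that does not decrease from a point along any velocity at that point,
and on `V ∩ h ⁻¹' R` singles out the velocity along which it does not change. -/
structure Conserves (G : E → Set E) (V : Submodule ℝ E) (h : E → ℝ) (R : Set ℝ) : Prop where
  continuous : Continuous h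
  subset_submodule : ∀ x, G x ⊆ V
  le_of_mem : ∀ x, ∀ g ∈ G x, ∀ c : ℝ, h x ≤ h (x + c • g)
  eq_of_conserved : ∀ x ∈ V, h x ∈ R → ∀ c : ℝ, c ≠ 0 → ∀ g₁ ∈ G x, ∀ g₂ ∈ G x,
    h (x + c • g₁) = h x → h (x + c • g₂) = h x → g₁ = g₂

/-- Near each time `t ∈ I` the increments of `D` from `t` are the increments of the clock `θ`
times velocities in `G (D t)`. -/
def IsSecantSolution (G : E → Set E) (θ : ℝ → ℝ) (I : Set ℝ) (D : ℝ → E) : Prop :=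
  ∀ t ∈ I, ∀ᶠ s in 𝓝[I] t, ∃ g ∈ G (D t), D s - D t = (θ s - θ t) • g

/-- The increments of `Γ` over `[s, t]` are, up to an error `η` in the duration, averages of
velocities at times `η`-close to `[s, t]`. -/
def IsApproxSolution (G : E → Set E) (η : ℝ) (Γ : ℝ → E) : Prop :=
  ∀ s t, s ≤ t → ∀ C : Set E, Convex ℝ C → IsClosed C →
    (∀ τ ∈ Icc (s - η) (t + η), G (Γ τ) ⊆ C) →
    ∃ c ∈ C, ∃ r : ℝ, |r - (t - s)| ≤ η ∧ Γ t - Γ s = r • c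

variable {G : E → Set E} {K : ℝ}

theorem IsLocallyMaximal.nonneg (hG : IsLocallyMaximal G K) : 0 ≤ K := by
  obtain ⟨g, hg⟩ := hG.nonempty 0
  have := hG.subset_closedBall 0 hg
  rw [mem_closedBall_zero_iff] at this
  exact (norm_nonneg g).trans this

theorem eq_of_eventually_eq {α : Type*} {I : Set ℝ} (hI : IsPreconnected I) {f : ℝ → α}
    (hf : ∀ t ∈ I, ∀ᶠ s in 𝓝[I] t, f s = f t) : ∀ s ∈ I, ∀ t ∈ I, f s = f t := by
  intro s hs t ht
  have : PreconnectedSpace I := isPreconnected_iff_preconnectedSpace.1 hI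
  have hloc : IsLocallyConstant (fun x : I => f x) := by
    rw [IsLocallyConstant.iff_eventually_eq]
    intro x
    exact (eventually_nhds_subtype_iff I x (fun y => f y = f x)).2 (hf x x.2)
  exact hloc.apply_eq_of_preconnectedSpace ⟨s, hs⟩ ⟨t, ht⟩

/-- Every point is a local minimum, so `{x | f s ≤ f x}` is open; it is closed by continuity.
Exchanging `s` and `t` gives equality. -/
theorem eq_of_eventually_le {I : Set ℝ} (hI : IsPreconnected I) {f : ℝ → ℝ}
    (hc : ContinuousOn f I) (hf : ∀ t ∈ I, ∀ᶠ s in 𝓝[I] t, f t ≤ f s) :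
    ∀ s ∈ I, ∀ t ∈ I, f s = f t := by
  have key : ∀ s ∈ I, ∀ t ∈ I, f s ≤ f t := by
    intro s hs t ht
    have : PreconnectedSpace I := isPreconnected_iff_preconnectedSpace.1 hI
    have hcl : IsClopen {x : I | f s ≤ f x} := by
      refine ⟨isClosed_le continuous_const (continuousOn_iff_continuous_domRestrict.1 hc), ?_⟩
      rw [isOpen_iff_mem_nhds]
      intro x hx
      exact (eventually_nhds_subtype_iff I x (fun y => f s ≤ f y)).2
        ((hf x x.2).mono fun y hy => le_trans hx hy)
    have := hcl.eq_univ ⟨⟨s, hs⟩, le_refl (f s)⟩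
    exact (this.symm ▸ mem_univ (⟨t, ht⟩ : I) : (⟨t, ht⟩ : I) ∈ {x : I | f s ≤ f x})
  exact fun s hs t ht => le_antisymm (key s hs t ht) (key t ht s hs)

namespace IsSecantSolution

variable {θ : ℝ → ℝ} {I : Set ℝ} {D D₁ D₂ : ℝ → E} {V : Submodule ℝ E} {h : E → ℝ} {R : Set ℝ}

theorem mono (hD : IsSecantSolution G θ I D) {J : Set ℝ} (hJ : J ⊆ I) :
    IsSecantSolution G θ J D :=
  fun t ht => (hD t (hJ ht)).filter_mono (nhdsWithin_mono t hJ)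

theorem continuousOn (hG : IsLocallyMaximal G K) (hθ : Continuous θ)
    (hD : IsSecantSolution G θ I D) : ContinuousOn D I := by
  intro t ht
  refine tendsto_iff_norm_sub_tendsto_zero.2 ?_
  refine squeeze_zero' (.of_forall fun _ => norm_nonneg _) (g := fun s => |θ s - θ t| * K) ?_ ?_
  · filter_upwards [hD t ht] with s hs
    obtain ⟨g, hg, hgs⟩ := hs
    rw [hgs, norm_smul, Real.norm_eq_abs]
    have := mem_closedBall_zero_iff.1 (hG.subset_closedBall _ hg)
    gcongr
  · have : Continuous fun s => |θ s - θ t| * K := by fun_prop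
    have := this.tendsto t
    simp only [sub_self, abs_zero, zero_mul] at this
    exact this.mono_left nhdsWithin_le_nhds

theorem conserved (hG : IsLocallyMaximal G K) (hh : Conserves G V h R) (hθ : Continuous θ)
    (hI : IsPreconnected I) (hD : IsSecantSolution G θ I D) :
    ∀ s ∈ I, ∀ t ∈ I, h (D s) = h (D t) := by
  refine eq_of_eventually_le (f := fun s => h (D s)) hI
    (hh.continuous.comp_continuousOn (hD.continuousOn hG hθ)) fun t ht => ?_
  filter_upwards [hD t ht] with s ⟨g, hg, hs⟩
  rw [sub_eq_iff_eq_add'] at hs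
  rw [hs]
  exact hh.le_of_mem _ g hg _

theorem mem_submodule_iff (hh : Conserves G V h R)
    (hI : IsPreconnected I) (hD : IsSecantSolution G θ I D) :
    ∀ s ∈ I, ∀ t ∈ I, D s ∈ V → D t ∈ V := by
  intro s hs t ht hst
  refine (eq_of_eventually_eq (f := fun s => D s ∈ V) hI (fun r hr => ?_) s hs t ht).mp hst
  filter_upwards [hD r hr] with s ⟨g, hg, hs⟩
  rw [sub_eq_iff_eq_add'] at hs
  rw [hs]
  exact propext (V.add_mem_iff_left (V.smul_mem _ (hh.subset_submodule _ hg)))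

/-- From a common point both solutions advance by the same nonzero clock increment, and `h` is
conserved along both, so `eq_of_conserved` identifies the velocities. Agreement is therefore open,
and it is closed by continuity. -/
theorem eqOn (hG : IsLocallyMaximal G K) (hh : Conserves G V h R) (hθ : Continuous θ)
    (hinj : Function.Injective θ) (hI : IsPreconnected I)
    (h₁ : IsSecantSolution G θ I D₁) (h₂ : IsSecantSolution G θ I D₂) {t₀ : ℝ} (ht₀ : t₀ ∈ I)
    (heq : D₁ t₀ = D₂ t₀) (hV : D₁ t₀ ∈ V) (hR : h (D₁ t₀) ∈ R) : EqOn D₁ D₂ I := by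
  intro s hs
  have hcl : ∀ t ∈ I, D₁ t = D₂ t → ∀ᶠ s in 𝓝[I] t, D₁ s = D₂ s := by
    intro t ht htt
    filter_upwards [h₁ t ht, h₂ t ht, self_mem_nhdsWithin] with s ⟨g₁, hg₁, e₁⟩ ⟨g₂, hg₂, e₂⟩ hsI
    rcases eq_or_ne s t with rfl | hne
    · exact htt
    have c₁ := h₁.conserved hG hh hθ hI s hsI t ht
    have c₂ := h₂.conserved hG hh hθ hI s hsI t ht
    rw [sub_eq_iff_eq_add'] at e₁ e₂
    rw [e₁] at c₁
    rw [e₂] at c₂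
    rw [← htt] at hg₂ e₂ c₂
    have := hh.eq_of_conserved (D₁ t) (h₁.mem_submodule_iff hh hI t₀ ht₀ t ht hV)
      ((h₁.conserved hG hh hθ hI t₀ ht₀ t ht) ▸ hR) _ (sub_ne_zero.2 (hinj.ne hne)) g₁ hg₁ g₂ hg₂
      c₁ c₂
    rw [e₁, e₂, this]
  have : PreconnectedSpace I := isPreconnected_iff_preconnectedSpace.1 hI
  have hclopen : IsClopen {x : I | D₁ x = D₂ x} := by
    refine ⟨isClosed_eq (continuousOn_iff_continuous_domRestrict.1 (h₁.continuousOn hG hθ))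
      (continuousOn_iff_continuous_domRestrict.1 (h₂.continuousOn hG hθ)), ?_⟩
    rw [isOpen_iff_mem_nhds]
    intro x hx
    exact (eventually_nhds_subtype_iff I x (fun y => D₁ y = D₂ y)).2 (hcl x x.2 hx)
  have := hclopen.eq_univ ⟨⟨t₀, ht₀⟩, heq⟩
  exact (this.symm ▸ mem_univ (⟨s, hs⟩ : I) : (⟨s, hs⟩ : I) ∈ {x : I | D₁ x = D₂ x})

theorem comp {ψ : ℝ → ℝ} (hψ : Continuous ψ) (hD : IsSecantSolution G id univ D) :
    IsSecantSolution G ψ univ (D ∘ ψ) := by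
  intro t _
  rw [nhdsWithin_univ]
  have := hD (ψ t) (mem_univ _)
  rw [nhdsWithin_univ] at this
  exact hψ.continuousAt.eventually this

end IsSecantSolution

namespace IsApproxSolution

variable {η : ℝ} {Γ : ℝ → E}

theorem norm_sub_le (hG : IsLocallyMaximal G K) (hΓ : IsApproxSolution G η Γ) (s t : ℝ) :
    ‖Γ t - Γ s‖ ≤ K * (|t - s| + η) := by
  wlog hst : s ≤ t generalizing s t
  · rw [norm_sub_rev, abs_sub_comm]
    exact this t s (le_of_not_ge hst)
  obtain ⟨c, hc, r, hr, e⟩ := hΓ s t hst (Metric.closedBall 0 K) (convex_closedBall 0 K)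
    Metric.isClosed_closedBall fun τ _ => hG.subset_closedBall _
  rw [e, norm_smul, Real.norm_eq_abs, mul_comm]
  have := mem_closedBall_zero_iff.1 hc
  have h2 : |r| ≤ |t - s| + η := by
    calc |r| = |(t - s) + (r - (t - s))| := by congr 1; ring
      _ ≤ _ := (abs_add_le _ _).trans (by gcongr)
  have := hG.nonneg
  gcongr

theorem lipschitzWith (hG : IsLocallyMaximal G K) (hΓ : IsApproxSolution G 0 Γ) :
    LipschitzWith K.toNNReal Γ := by
  refine LipschitzWith.of_dist_le_mul fun s t => ?_
  rw [dist_eq_norm, Real.dist_eq, Real.coe_toNNReal _ hG.nonneg]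
  simpa using hΓ.norm_sub_le hG t s

/-- On a short interval around `t` all velocities lie in the closed convex set `G (Γ t)`, which
serves as `C`. -/
theorem isSecantSolution (hG : IsLocallyMaximal G K) (hΓ : IsApproxSolution G 0 Γ) :
    IsSecantSolution G id univ Γ := by
  intro t _
  rw [nhdsWithin_univ]
  have hev : ∀ᶠ s in 𝓝 t, G (Γ s) ⊆ G (Γ t) :=
    (hΓ.lipschitzWith hG).continuous.continuousAt.eventually (hG.eventually_subset (Γ t))
  obtain ⟨ε, hε, hball⟩ := Metric.eventually_nhds_iff_ball.1 hev
  filter_upwards [Metric.ball_mem_nhds t hε] with s hs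
  rcases le_total t s with hts | hts
  · obtain ⟨c, hc, r, hr, e⟩ := hΓ t s hts _ (hG.convex (Γ t)) (hG.isClosed (Γ t)) fun τ hτ =>
      hball τ (by
        rw [Metric.mem_ball, Real.dist_eq, abs_lt] at hs ⊢
        constructor <;> linarith [hτ.1, hτ.2])
    refine ⟨c, hc, ?_⟩
    rw [e, id, id, sub_eq_zero.1 (abs_nonpos_iff.1 hr)]
  · obtain ⟨c, hc, r, hr, e⟩ := hΓ s t hts _ (hG.convex (Γ t)) (hG.isClosed (Γ t)) fun τ hτ =>
      hball τ (by
        rw [Metric.mem_ball, Real.dist_eq, abs_lt] at hs ⊢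
        constructor <;> linarith [hτ.1, hτ.2])
    refine ⟨c, hc, ?_⟩
    rw [← neg_sub (Γ t), e, id, id, sub_eq_zero.1 (abs_nonpos_iff.1 hr), ← neg_smul, neg_sub]

/-- Along an ultrafilter, approximate solutions with errors tending to zero and converging initial
values converge pointwise to a solution. -/
theorem exists_limit [FiniteDimensional ℝ E] (hG : IsLocallyMaximal G K) {ι : Type*}
    (U : Ultrafilter ι) {η : ι → ℝ} {Γ : ι → ℝ → E} (hη : Tendsto η U (𝓝 0))
    (hΓ : ∀ i, IsApproxSolution G (η i) (Γ i)) {x : E} (h0 : Tendsto (fun i => Γ i 0) U (𝓝 x)) :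
    ∃ Γ₀ : ℝ → E, Γ₀ 0 = x ∧ (∀ t, Tendsto (fun i => Γ i t) U (𝓝 (Γ₀ t))) ∧
      IsApproxSolution G 0 Γ₀ := by
  have : ProperSpace E := FiniteDimensional.proper ℝ E
  have hK := hG.nonneg
  have hlim : ∀ t : ℝ, ∃ y, Tendsto (fun i => Γ i t) U (𝓝 y) := by
    intro t
    have hmem : Metric.closedBall x (K * (|t| + 1) + 1) ∈ U.map (fun i => Γ i t) := by
      rw [← Ultrafilter.mem_coe, Ultrafilter.coe_map, Filter.mem_map]
      filter_upwards [h0 (Metric.ball_mem_nhds x one_pos),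
        hη.eventually (gt_mem_nhds (one_pos : (0 : ℝ) < 1))] with i hi hi'
      rw [mem_preimage, Metric.mem_closedBall]
      calc dist (Γ i t) x ≤ dist (Γ i t) (Γ i 0) + dist (Γ i 0) x := dist_triangle _ _ _
        _ ≤ K * (|t| + 1) + 1 := by
          refine add_le_add ?_ (le_of_lt hi)
          rw [dist_eq_norm]
          refine ((hΓ i).norm_sub_le hG 0 t).trans ?_
          rw [sub_zero]
          gcongr
    obtain ⟨y, -, hy⟩ := (isCompact_closedBall x _).ultrafilter_le_nhds' _ hmem
    exact ⟨y, hy⟩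
  choose Γ₀ hΓ₀ using hlim
  refine ⟨Γ₀, tendsto_nhds_unique (hΓ₀ 0) h0, hΓ₀, ?_⟩
  intro s t hst C hC hCc hsub
  rw [sub_zero, add_zero] at hsub
  -- The Lipschitz bound up to `η` upgrades pointwise convergence to joint convergence in index and
  -- time.
  have hjoint : ∀ τ : ℝ, Tendsto (fun p : ι × ℝ => Γ p.1 p.2) (U ×ˢ 𝓝 τ) (𝓝 (Γ₀ τ)) := by
    intro τ
    rw [tendsto_iff_norm_sub_tendsto_zero]
    refine squeeze_zero (fun _ => norm_nonneg _)
      (g := fun p => K * (|p.2 - τ| + η p.1) + ‖Γ p.1 τ - Γ₀ τ‖) (fun p => ?_) ?_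
    · calc ‖Γ p.1 p.2 - Γ₀ τ‖ ≤ ‖Γ p.1 p.2 - Γ p.1 τ‖ + ‖Γ p.1 τ - Γ₀ τ‖ :=
            norm_sub_le_norm_sub_add_norm_sub _ _ _
        _ ≤ _ := by gcongr; exact (hΓ p.1).norm_sub_le hG _ _
    · have a1 : Tendsto (fun p : ι × ℝ => |p.2 - τ|) (U ×ˢ 𝓝 τ) (𝓝 0) := by
        have : Tendsto (fun r : ℝ => |r - τ|) (𝓝 τ) (𝓝 0) := by
          have hc : Continuous fun r : ℝ => |r - τ| := by fun_prop
          simpa using hc.tendsto τ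
        exact this.comp tendsto_snd
      have a2 : Tendsto (fun p : ι × ℝ => η p.1) (U ×ˢ 𝓝 τ) (𝓝 0) := hη.comp tendsto_fst
      have a3 : Tendsto (fun p : ι × ℝ => ‖Γ p.1 τ - Γ₀ τ‖) (U ×ˢ 𝓝 τ) (𝓝 0) :=
        (tendsto_iff_norm_sub_tendsto_zero.1 (hΓ₀ τ)).comp tendsto_fst
      simpa using ((a1.add a2).const_mul K).add a3
  -- By compactness of `[s, t]`, a single set of indices and a single neighbourhood of the interval
  -- serve all times.
  have hnear : {p : ι × ℝ | G (Γ p.1 p.2) ⊆ C} ∈ (U : Filter ι) ×ˢ 𝓝ˢ (Icc s t) := by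
    refine isCompact_Icc.mem_prod_nhdsSet_of_forall fun τ hτ => ?_
    filter_upwards [(hjoint τ).eventually (hG.eventually_subset (Γ₀ τ))] with p hp
    exact hp.trans (hsub τ hτ)
  obtain ⟨A, hA, B, hB, hAB⟩ := mem_prod_iff.1 hnear
  obtain ⟨δ, hδ, hδB⟩ := isCompact_Icc.exists_cthickening_subset_open isOpen_interior
    (subset_interior_iff_mem_nhdsSet.2 hB)
  -- Cutting with the ball makes the set of mean velocities compact, so they converge along the
  -- ultrafilter.
  set C' := C ∩ Metric.closedBall (0 : E) K with hC'
  have hcomp : IsCompact C' := (isCompact_closedBall (0 : E) K).inter_left hCc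
  have hev : ∀ᶠ i in (U : Filter ι), ∃ p : E × ℝ, p.1 ∈ C' ∧ |p.2 - (t - s)| ≤ η i ∧
      Γ i t - Γ i s = p.2 • p.1 := by
    filter_upwards [hA, hη.eventually (gt_mem_nhds hδ)] with i hi hi'
    have hC'sub : ∀ τ ∈ Icc (s - η i) (t + η i), G (Γ i τ) ⊆ C' := by
      intro τ hτ
      refine subset_inter (hAB (mk_mem_prod hi (interior_subset (hδB ?_)))) (hG.subset_closedBall _)
      refine Metric.mem_cthickening_of_dist_le τ (max s (min τ t)) δ _
        ⟨le_max_left _ _, max_le hst (min_le_right _ _)⟩ ?_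
      rw [Real.dist_eq, abs_le]
      have h1 := hτ.1
      have h2 := hτ.2
      constructor <;> rcases le_total τ t with h | h <;>
        rcases le_total s τ with h' | h' <;> simp [h, h', hst] <;> linarith
    obtain ⟨c, hc, r, hr, e⟩ := hΓ i s t hst C' (hC.inter (convex_closedBall 0 K))
      (hCc.inter Metric.isClosed_closedBall) hC'sub
    exact ⟨(c, r), hc, hr, e⟩
  obtain ⟨p, hp⟩ := Filter.skolem.1 hev
  obtain ⟨c, hc, hlc⟩ := hcomp.ultrafilter_le_nhds' (U.map fun i => (p i).1) (by
    rw [← Ultrafilter.mem_coe, Ultrafilter.coe_map, Filter.mem_map]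
    filter_upwards [hp] with i hi using hi.1)
  refine ⟨c, hc.1, t - s, by simp, ?_⟩
  have hr : Tendsto (fun i => (p i).2) U (𝓝 (t - s)) := by
    rw [tendsto_iff_norm_sub_tendsto_zero]
    exact squeeze_zero' (.of_forall fun _ => norm_nonneg _) (hp.mono fun i hi => hi.2.1) hη
  refine tendsto_nhds_unique ((hΓ₀ t).sub (hΓ₀ s)) ((hr.smul hlc).congr' ?_)
  filter_upwards [hp] with i hi using hi.2.2.symm

end IsApproxSolution

end Inclusion

/-! ### Euler polygons, existence, and dependence on the initial value -/

section Existence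

variable {E : Type*} [NormedAddCommGroup E] [NormedSpace ℝ E] {G : E → Set E} {K : ℝ}

theorem exists_smul_eq_of_steps {ε : ℝ} (hε : 0 < ε) {g : E → E} (hg : ∀ x, g x ∈ G x) {y : ℤ → E}
    (hy : ∀ j, ∃ i, j ≤ i ∧ i ≤ j + 1 ∧ y (j + 1) - y j = ε • g (y i)) {C : Set E}
    (hC : Convex ℝ C) {a b : ℤ} (hab : a ≤ b) (hsub : ∀ j, a ≤ j → j ≤ b → G (y j) ⊆ C) :
    ∃ c ∈ C, y b - y a = (((b : ℝ) - a) * ε) • c := by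
  induction b, hab using Int.leInduction with
  | base => exact ⟨g (y a), hsub a le_rfl le_rfl (hg _), by simp⟩
  | succ b hab ih =>
    obtain ⟨c, hc, e⟩ := ih fun j h1 h2 => hsub j h1 (by omega)
    obtain ⟨i, hi, hi', e'⟩ := hy b
    have hgi : g (y i) ∈ C := hsub i (hab.trans hi) hi' (hg _)
    have hba : (0 : ℝ) ≤ (b : ℝ) - a := by
      rw [sub_nonneg]
      exact_mod_cast hab
    refine ⟨(((b : ℝ) - a) / ((b : ℝ) - a + 1)) • c + (1 / ((b : ℝ) - a + 1)) • g (y i),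
      hC hc hgi (by positivity) (by positivity) (by field_simp), ?_⟩
    rw [← sub_add_sub_cancel (y (b + 1)) (y b) (y a), e, e', smul_add, smul_smul, smul_smul,
      add_comm]
    push_cast
    congr 2 <;> field_simp <;> ring

theorem exists_isApproxSolution (hG : IsLocallyMaximal G K) {ε : ℝ} (hε : 0 < ε) (x : E) :
    ∃ Γ : ℝ → E, Γ 0 = x ∧ IsApproxSolution G ε Γ := by
  choose g hg using hG.nonempty
  -- Euler steps are explicit in both time directions: the increment from `j` to `j + 1` uses the
  -- velocity at `j` for `j ≥ 0` and at `j + 1` for `j < 0`.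
  let y : ℤ → E := fun j => Int.casesOn j (fun n => (fun z => z + ε • g z)^[n] x)
    (fun n => (fun z => z - ε • g z)^[n + 1] x)
  have hneg : ∀ n : ℕ, y (-(n : ℤ)) = (fun z => z - ε • g z)^[n] x := by
    rintro (_ | n)
    · rfl
    · rfl
  have hpos : ∀ n : ℕ, y n = (fun z => z + ε • g z)^[n] x := fun n => rfl
  have hy : ∀ j, ∃ i, j ≤ i ∧ i ≤ j + 1 ∧ y (j + 1) - y j = ε • g (y i) := by
    intro j
    rcases le_or_gt 0 j with h | h
    · obtain ⟨n, rfl⟩ := Int.eq_ofNat_of_zero_le h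
      refine ⟨n, le_rfl, by omega, ?_⟩
      have : y ((n : ℤ) + 1) = y n + ε • g (y n) := by
        have := hpos (n + 1)
        rw [Function.iterate_succ_apply', ← hpos] at this
        exact_mod_cast this
      rw [this]
      abel
    · obtain ⟨n, hn⟩ := Int.eq_ofNat_of_zero_le (show 0 ≤ -(j + 1) by omega)
      have hj1 : j + 1 = -(n : ℤ) := by omega
      have hj : j = -((n + 1 : ℕ) : ℤ) := by push_cast; omega
      refine ⟨j + 1, by omega, le_rfl, ?_⟩
      have : y j = y (j + 1) - ε • g (y (j + 1)) := by
        rw [hj1, hj, hneg, Function.iterate_succ_apply', hneg]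
      rw [this]
      abel
  -- Rounding to multiples of `ε` shifts the nodes and changes the duration by at most `ε`, which is
  -- the admitted error.
  refine ⟨fun t => y ⌊t / ε⌋, ?_, ?_⟩
  · simp only [zero_div, Int.floor_zero]
    rfl
  · intro s t hst C hC _ hsub
    have hab : ⌊s / ε⌋ ≤ ⌊t / ε⌋ := Int.floor_le_floor (by gcongr)
    have b1 := Int.floor_le (s / ε)
    have b2 := Int.lt_floor_add_one (s / ε)
    have b3 := Int.floor_le (t / ε)
    have b4 := Int.lt_floor_add_one (t / ε)
    rw [le_div_iff₀ hε] at b1 b3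
    rw [div_lt_iff₀ hε] at b2 b4
    obtain ⟨c, hc, e⟩ := exists_smul_eq_of_steps hε hg hy hC hab (fun j h1 h2 => by
      have h1' : (⌊s / ε⌋ : ℝ) ≤ j := by exact_mod_cast h1
      have h2' : (j : ℝ) ≤ ⌊t / ε⌋ := by exact_mod_cast h2
      have := hsub (j * ε) ⟨by nlinarith, by nlinarith⟩
      simpa [hε.ne'] using this)
    refine ⟨c, hc, _, ?_, e⟩
    rw [abs_le]
    constructor <;> nlinarith

theorem exists_isApproxSolution_zero [FiniteDimensional ℝ E] (hG : IsLocallyMaximal G K) (x : E) :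
    ∃ Γ : ℝ → E, Γ 0 = x ∧ IsApproxSolution G 0 Γ := by
  choose Γ h0 hΓ using fun n : ℕ =>
    exists_isApproxSolution hG (ε := 1 / ((n : ℝ) + 1)) (by positivity) x
  obtain ⟨Γ₀, h, -, h'⟩ := IsApproxSolution.exists_limit hG (hyperfilter ℕ)
    (tendsto_one_div_add_atTop_nhds_zero_nat.mono_left Nat.hyperfilter_le_atTop) hΓ (x := x)
    (by simp only [h0]; exact tendsto_const_nhds)
  exact ⟨Γ₀, h, h'⟩

/-- A limit along an ultrafilter of solutions whose initial values tend to `x` is a solution from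
`x`, hence is `Γ x` by uniqueness. The common Lipschitz constant in time makes the continuity joint.
-/
theorem continuousAt_solution [FiniteDimensional ℝ E] (hG : IsLocallyMaximal G K)
    {V : Submodule ℝ E} {h : E → ℝ} {R : Set ℝ} (hh : Conserves G V h R) {Γ : E → ℝ → E}
    (h0 : ∀ x, Γ x 0 = x) (hΓ : ∀ x, IsApproxSolution G 0 (Γ x)) {x : E} (hV : x ∈ V)
    (hR : h x ∈ R) (t : ℝ) : ContinuousAt (fun p : ℝ × E => Γ p.2 p.1) (t, x) := by
  have hfix : Tendsto (fun y => Γ y t) (𝓝 x) (𝓝 (Γ x t)) := by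
    rw [tendsto_iff_ultrafilter]
    intro U hU
    obtain ⟨Γ₀, h1, h2, h3⟩ := IsApproxSolution.exists_limit hG U (η := fun _ => 0)
      tendsto_const_nhds hΓ (x := x) (by simp only [h0]; exact hU)
    have heq := (h3.isSecantSolution hG).eqOn hG hh continuous_id Function.injective_id
      isPreconnected_univ ((hΓ x).isSecantSolution hG) (mem_univ 0) (by rw [h1, h0])
      (by rwa [h1]) (by rwa [h1])
    rw [← heq (mem_univ t)]
    exact h2 t
  rw [ContinuousAt, tendsto_iff_norm_sub_tendsto_zero]
  refine squeeze_zero (fun _ => norm_nonneg _)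
    (g := fun p : ℝ × E => K * (|p.1 - t| + 0) + ‖Γ p.2 t - Γ x t‖) (fun p => ?_) ?_
  · calc ‖Γ p.2 p.1 - Γ x t‖ ≤ ‖Γ p.2 p.1 - Γ p.2 t‖ + ‖Γ p.2 t - Γ x t‖ :=
          norm_sub_le_norm_sub_add_norm_sub _ _ _
      _ ≤ _ := by gcongr; exact (hΓ p.2).norm_sub_le hG _ _
  · have a1 : Tendsto (fun p : ℝ × E => K * (|p.1 - t| + 0)) (𝓝 (t, x)) (𝓝 0) := by
      have hc : Continuous fun p : ℝ × E => K * (|p.1 - t| + 0) := by fun_prop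
      simpa using hc.tendsto (t, x)
    have a2 : Tendsto (fun p : ℝ × E => ‖Γ p.2 t - Γ x t‖) (𝓝 (t, x)) (𝓝 0) :=
      (tendsto_iff_norm_sub_tendsto_zero.1 hfix).comp continuousAt_snd
    simpa using a1.add a2

end Existence

/-! ### Absolutely continuous curves and a mean value inclusion -/

section AbsoluteContinuity

theorem _root_.AbsolutelyContinuousOnInterval.comp_lipschitzWith {X Y : Type*}
    [PseudoMetricSpace X] [PseudoMetricSpace Y] {f : ℝ → X} {a b : ℝ} {K : NNReal} {φ : X → Y}
    (hφ : LipschitzWith K φ) (hf : AbsolutelyContinuousOnInterval f a b) :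
    AbsolutelyContinuousOnInterval (fun t => φ (f t)) a b := by
  unfold AbsolutelyContinuousOnInterval at hf ⊢
  refine squeeze_zero (fun t => Finset.sum_nonneg fun i _ => dist_nonneg) (fun t => ?_)
    (by simpa using hf.const_mul (K : ℝ))
  rw [Finset.mul_sum]
  exact Finset.sum_le_sum fun i _ => hφ.dist_le_mul _ _

theorem absolutelyContinuousOnInterval_const {X : Type*} [PseudoMetricSpace X] (c : X) (a b : ℝ) :
    AbsolutelyContinuousOnInterval (fun _ => c) a b :=
  (LipschitzWith.const c).lipschitzOnWith.absolutelyContinuousOnInterval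

theorem absolutelyContinuousOnInterval_exp (a b : ℝ) :
    AbsolutelyContinuousOnInterval Real.exp a b :=
  Real.contDiff_exp.contDiffOn.absolutelyContinuousOnInterval

theorem continuousOn_of_forall_uIcc {X : Type*} [TopologicalSpace X] {f : ℝ → X} {I : Set ℝ}
    (hf : ∀ a ∈ I, ∀ b ∈ I, ContinuousOn f (uIcc a b)) : ContinuousOn f I := by
  intro t ht
  have h1 : ContinuousWithinAt f (I ∩ Ici t) t := by
    by_cases hb : ∃ b ∈ I, t < b
    · obtain ⟨b, hbI, htb⟩ := hb
      refine (hf t ht b hbI t left_mem_uIcc).mono_of_mem_nhdsWithin ?_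
      filter_upwards [self_mem_nhdsWithin, mem_nhdsWithin_of_mem_nhds (Iio_mem_nhds htb)]
        with s hs hs'
      rw [uIcc_of_le htb.le]
      exact ⟨hs.2, le_of_lt hs'⟩
    · push Not at hb
      exact continuousWithinAt_singleton.mono fun s hs => le_antisymm (hb s hs.1) hs.2
  have h2 : ContinuousWithinAt f (I ∩ Iic t) t := by
    by_cases hb : ∃ b ∈ I, b < t
    · obtain ⟨b, hbI, htb⟩ := hb
      refine (hf t ht b hbI t left_mem_uIcc).mono_of_mem_nhdsWithin ?_
      filter_upwards [self_mem_nhdsWithin, mem_nhdsWithin_of_mem_nhds (Ioi_mem_nhds htb)]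
        with s hs hs'
      rw [uIcc_of_ge htb.le]
      exact ⟨le_of_lt hs', hs.2⟩
    · push Not at hb
      exact continuousWithinAt_singleton.mono fun s hs => le_antisymm hs.2 (hb s hs.1)
  refine (h1.union h2).mono fun s hs => ?_
  rcases le_total t s with h | h
  · exact .inl ⟨hs, h⟩
  · exact .inr ⟨hs, h⟩

variable {E : Type*} [NormedAddCommGroup E] [NormedSpace ℝ E]

/-- If the mean velocity were outside `C`, a functional `f` would separate it strictly, with `f < u`
on `C`. But `u * exp t - f (D t)` is absolutely continuous with nonnegative derivative almost
everywhere, so it cannot decrease from `a` to `b`. -/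
theorem exists_smul_eq_of_ae_hasDerivAt {C : Set E} (hC : Convex ℝ C) (hCc : IsClosed C)
    {D : ℝ → E} {a b : ℝ} (hab : a < b) (hD : AbsolutelyContinuousOnInterval D a b)
    (hder : ∀ᵐ t ∂(volume : Measure ℝ), t ∈ Icc a b →
      ∃ g ∈ C, HasDerivAt D (Real.exp t • g) t) :
    ∃ g ∈ C, D b - D a = (Real.exp b - Real.exp a) • g := by
  have hpos : 0 < Real.exp b - Real.exp a := sub_pos.2 (Real.exp_lt_exp.2 hab)
  refine ⟨(Real.exp b - Real.exp a)⁻¹ • (D b - D a), ?_, by rw [smul_inv_smul₀ hpos.ne']⟩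
  by_contra hnot
  obtain ⟨f, u, hu, hfu⟩ := geometric_hahn_banach_closed_point hC hCc hnot
  set φ : ℝ → ℝ := fun t => u * Real.exp t - f (D t) with hφ
  have hac : AbsolutelyContinuousOnInterval φ a b :=
    ((absolutelyContinuousOnInterval_exp a b).const_mul u).fun_sub
      (hD.comp_lipschitzWith f.lipschitz)
  have hint := hac.integral_deriv_eq_sub
  have hnn : 0 ≤ ∫ t in a..b, deriv φ t := by
    refine intervalIntegral.integral_nonneg_of_ae_restrict hab.le ?_
    rw [EventuallyLE, ae_restrict_iff' measurableSet_Icc]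
    filter_upwards [hder] with t ht htm
    obtain ⟨g, hg, hgt⟩ := ht htm
    have hd : HasDerivAt φ (u * Real.exp t - f (Real.exp t • g)) t :=
      ((Real.hasDerivAt_exp t).const_mul u).sub (f.hasFDerivAt.comp_hasDerivAt t hgt)
    rw [hd.deriv, map_smul, smul_eq_mul]
    have := hu g hg
    have := Real.exp_pos t
    simp only [Pi.zero_apply]
    nlinarith
  rw [hint] at hnn
  simp only [hφ] at hnn
  rw [map_smul, map_sub, smul_eq_mul, inv_mul_eq_div, lt_div_iff₀ hpos] at hfu
  linarith

end AbsoluteContinuity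

/-! ### Rescaling between the original and the homogeneous inclusion; the flow -/

section Flow

variable {E : Type*} [NormedAddCommGroup E] [NormedSpace ℝ E] {G : E → Set E} {K : ℝ}
  {F : E → Set E} {zbar : E}

/-- The derivative of `e^t (δ - zbar)` is `e^t (δ' + δ - zbar)`, and by scale invariance `G` may be
evaluated at the rescaled point. Near `t` all these velocities lie in `G (D t)`, so the mean value
inclusion applies. -/
theorem isSecantSolution_of_isSolutionOn (hG : IsLocallyMaximal G K)
    (hscale : ∀ (x : E) (c : ℝ), 0 < c → G (c • x) = G x)
    (hF : ∀ z v, v ∈ F z ↔ v + (z - zbar) ∈ G (z - zbar)) {I : Set ℝ} (hI : I.OrdConnected)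
    {δ : ℝ → E} (hδ : IsSolutionOn F I δ) :
    IsSecantSolution G Real.exp I (fun t => Real.exp t • (δ t - zbar)) := by
  set D : ℝ → E := fun t => Real.exp t • (δ t - zbar) with hDdef
  have hac : ∀ a ∈ I, ∀ b ∈ I, AbsolutelyContinuousOnInterval D a b := fun a ha b hb =>
    (absolutelyContinuousOnInterval_exp a b).fun_smul
      ((hδ.1 a ha b hb).fun_sub (absolutelyContinuousOnInterval_const zbar a b))
  have hcont : ContinuousOn D I :=
    continuousOn_of_forall_uIcc fun a ha b hb => (hac a ha b hb).continuousOn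
  have hder : ∀ᵐ t ∂(volume : Measure ℝ), t ∈ I →
      ∃ g ∈ G (D t), HasDerivAt D (Real.exp t • g) t := by
    filter_upwards [hδ.2] with t ht htI
    obtain ⟨v, hv, hvt⟩ := ht htI
    refine ⟨v + (δ t - zbar), ?_, ?_⟩
    · rw [hDdef]
      simp only
      rw [hscale _ _ (Real.exp_pos t)]
      exact (hF _ _).1 hv
    · rw [smul_add]
      exact (Real.hasDerivAt_exp t).fun_smul (hvt.sub_const zbar)
  intro t ht
  have hev := (hcont t ht).eventually (hG.eventually_subset (D t))
  obtain ⟨ε, hε, hball⟩ := Metric.mem_nhdsWithin_iff.1 hev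
  filter_upwards [self_mem_nhdsWithin, mem_nhdsWithin_of_mem_nhds (Metric.ball_mem_nhds t hε)]
    with s hsI hsε
  have hsub : ∀ τ ∈ uIcc s t, τ ∈ I ∧ G (D τ) ⊆ G (D t) := by
    intro τ hτ
    have hτI : τ ∈ I := hI.uIcc_subset hsI ht hτ
    exact ⟨hτI, hball ⟨(convex_ball t ε).ordConnected.uIcc_subset hsε
      (Metric.mem_ball_self hε) hτ, hτI⟩⟩
  rcases lt_trichotomy t s with h | rfl | h
  · refine exists_smul_eq_of_ae_hasDerivAt (hG.convex (D t)) (hG.isClosed (D t)) h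
      (hac t ht s hsI) ?_
    filter_upwards [hder] with τ hτ hτm
    have := hsub τ (by rwa [uIcc_of_ge h.le])
    obtain ⟨g, hg, hg'⟩ := hτ this.1
    exact ⟨g, this.2 hg, hg'⟩
  · obtain ⟨g, hg⟩ := hG.nonempty (D t)
    exact ⟨g, hg, by simp⟩
  · obtain ⟨g, hg, e⟩ := exists_smul_eq_of_ae_hasDerivAt (hG.convex (D t)) (hG.isClosed (D t)) h
      (hac s hsI t ht) (by
        filter_upwards [hder] with τ hτ hτm
        have := hsub τ (by rwa [uIcc_of_le h.le])
        obtain ⟨g, hg, hg'⟩ := hτ this.1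
        exact ⟨g, this.2 hg, hg'⟩)
    refine ⟨g, hg, ?_⟩
    rw [← neg_sub (D t), e, ← neg_smul, neg_sub]

/-- The preimage of a null set under `exp t - 1` is the image of its part in `r > -1` under the
differentiable map `log (r + 1)`, hence null. -/
theorem ae_exp_sub_one {p : ℝ → Prop} (hp : ∀ᵐ r ∂(volume : Measure ℝ), p r) :
    ∀ᵐ t ∂(volume : Measure ℝ), p (Real.exp t - 1) := by
  rw [ae_iff] at hp ⊢
  have h0 : volume ({r | ¬ p r} ∩ Ioi (-1)) = 0 := measure_mono_null inter_subset_left hp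
  refine measure_mono_null ?_ (addHaar_image_eq_zero_of_differentiableOn_of_addHaar_eq_zero
    (f := fun r => Real.log (r + 1)) volume (fun r hr => ?_) h0)
  · intro t ht
    exact ⟨Real.exp t - 1, ⟨ht, by simpa using Real.exp_pos t⟩, by simp⟩
  · have : r + 1 ≠ 0 := by
      have := hr.2
      rw [mem_Ioi] at this
      linarith
    exact ((differentiableAt_id.add_const 1).log this).differentiableWithinAt

theorem isSolutionOn_of_isApproxSolution [FiniteDimensional ℝ E] (hG : IsLocallyMaximal G K)
    (hscale : ∀ (x : E) (c : ℝ), 0 < c → G (c • x) = G x)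
    (hF : ∀ z v, v ∈ F z ↔ v + (z - zbar) ∈ G (z - zbar)) {Γ : ℝ → E}
    (hΓ : IsApproxSolution G 0 Γ) :
    IsSolutionOn F univ (fun t => zbar + Real.exp (-t) • Γ (Real.exp t - 1)) := by
  have hLip := hΓ.lipschitzWith hG
  constructor
  · intro a _ b _
    refine (absolutelyContinuousOnInterval_const zbar a b).fun_add
      (AbsolutelyContinuousOnInterval.fun_smul ?_ ?_)
    · have : ContDiff ℝ 1 fun t : ℝ => Real.exp (-t) := Real.contDiff_exp.comp contDiff_neg
      exact this.contDiffOn.absolutelyContinuousOnInterval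
    · exact ((absolutelyContinuousOnInterval_exp a b).fun_sub
        (absolutelyContinuousOnInterval_const 1 a b)).comp_lipschitzWith hLip
  · filter_upwards [ae_exp_sub_one hLip.ae_differentiableAt_real] with t ht _
    set ρ := Real.exp t - 1 with hρ
    have hd := ht.hasDerivAt
    -- The derivative is a limit of secant slopes, all of which lie in the closed set `G (Γ ρ)`.
    have hmem : deriv Γ ρ ∈ G (Γ ρ) := by
      refine (hG.isClosed _).mem_of_tendsto (hasDerivAt_iff_tendsto_slope.1 hd) ?_
      have := hΓ.isSecantSolution hG ρ (mem_univ _)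
      rw [nhdsWithin_univ] at this
      filter_upwards [mem_nhdsWithin_of_mem_nhds this, self_mem_nhdsWithin] with s ⟨g, hg, e⟩ hne
      rw [slope, vsub_eq_sub, e, id, id, inv_smul_smul₀ (sub_ne_zero.2 hne)]
      exact hg
    refine ⟨deriv Γ ρ - Real.exp (-t) • Γ ρ, (hF _ _).2 ?_, ?_⟩
    · rw [add_sub_cancel_left, sub_add_cancel, hscale _ _ (Real.exp_pos _)]
      exact hmem
    · have h1 : HasDerivAt (fun t => Real.exp (-t)) (-Real.exp (-t)) t := by
        simpa using (hasDerivAt_neg t).exp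
      have h2 : HasDerivAt (fun t => Γ (Real.exp t - 1)) (Real.exp t • deriv Γ ρ) t :=
        hd.scomp t ((Real.hasDerivAt_exp t).sub_const 1)
      have h3 := (h1.fun_smul h2).const_add zbar
      convert h3 using 1
      rw [smul_smul, ← Real.exp_add, neg_add_cancel, Real.exp_zero, one_smul, neg_smul,
        sub_eq_add_neg]

theorem hasUniqueSolution_and_generatesFlow [FiniteDimensional ℝ E] (hG : IsLocallyMaximal G K)
    (hscale : ∀ (x : E) (c : ℝ), 0 < c → G (c • x) = G x)
    (hF : ∀ z v, v ∈ F z ↔ v + (z - zbar) ∈ G (z - zbar))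
    {V : Submodule ℝ E} {h : E → ℝ} {R : Set ℝ} (hh : Conserves G V h R)
    (hR : ∀ (x : E) (c : ℝ), 0 < c → h x ∈ R → h (c • x) ∈ R) :
    (∀ z, z - zbar ∈ V → h (z - zbar) ∈ R → HasUniqueSolution F z) ∧
      GeneratesFlow F {z | z - zbar ∈ V ∧ h (z - zbar) ∈ R} := by
  choose Γ h0 hΓ using exists_isApproxSolution_zero hG
  have hclock : Continuous fun t : ℝ => Real.exp t - 1 := Real.continuous_exp.sub continuous_const
  -- The clock `exp t - 1` starts at zero with `t`; the constant drops out of the increments.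
  have hsec : ∀ x, IsSecantSolution G Real.exp univ (fun t => Γ x (Real.exp t - 1)) := by
    intro x t ht
    refine (((hΓ x).isSecantSolution hG).comp hclock t ht).mono fun s ⟨g, hg, e⟩ => ⟨g, hg, ?_⟩
    rw [sub_sub_sub_cancel_right] at e
    exact e
  have hstart : ∀ x, Γ x (Real.exp 0 - 1) = x := fun x => by rw [Real.exp_zero, sub_self, h0]
  have huniq : ∀ (x : E), x ∈ V → h x ∈ R → ∀ (I : Set ℝ), I.OrdConnected → (0 : ℝ) ∈ I →
      ∀ D : ℝ → E, IsSecantSolution G Real.exp I D → D 0 = x →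
        EqOn D (fun t => Γ x (Real.exp t - 1)) I := by
    intro x hV hRx I hI h0I D hD hDx
    exact hD.eqOn hG hh Real.continuous_exp Real.exp_injective hI.isPreconnected
      ((hsec x).mono (subset_univ I)) h0I (by rw [hDx]; exact (hstart x).symm) (by rwa [hDx])
      (by rwa [hDx])
  have hinv : ∀ x, x ∈ V → h x ∈ R → ∀ t, Γ x t ∈ V ∧ h (Γ x t) ∈ R := by
    intro x hV hRx t
    have hs := (hΓ x).isSecantSolution hG
    refine ⟨hs.mem_submodule_iff hh isPreconnected_univ 0 (mem_univ _) t (mem_univ _) ?_, ?_⟩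
    · rwa [h0]
    · rw [hs.conserved hG hh continuous_id isPreconnected_univ t (mem_univ _) 0 (mem_univ _), h0]
      exact hRx
  constructor
  · intro z hV hRz
    refine ⟨_, isSolutionOn_of_isApproxSolution hG hscale hF (hΓ (z - zbar)), ?_, ?_⟩
    · simp only [neg_zero, Real.exp_zero, one_smul, sub_self, h0]
      abel
    · intro I hI h0I δ hδ hδ0 t ht
      have := huniq _ hV hRz I hI h0I _ (isSecantSolution_of_isSolutionOn hG hscale hF hI hδ)
        (by simp [hδ0]) ht
      simp only at this ⊢
      rw [← this, smul_smul, ← Real.exp_add, neg_add_cancel, Real.exp_zero, one_smul]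
      abel
  · set S : Set E := {z | z - zbar ∈ V ∧ h (z - zbar) ∈ R} with hS
    let ψ : ℝ → E → E := fun t z => zbar + Real.exp (-t) • Γ (z - zbar) (Real.exp t - 1)
    have hψS : ∀ t, ∀ z ∈ S, ψ t z ∈ S := by
      intro t z hz
      have := hinv _ hz.1 hz.2 (Real.exp t - 1)
      simp only [hS, mem_ofPred_eq, ψ, add_sub_cancel_left]
      exact ⟨V.smul_mem _ this.1, hR _ _ (Real.exp_pos _) this.2⟩
    have hψadd : ∀ t s, ∀ z ∈ S, ψ (t + s) z = ψ t (ψ s z) := by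
      intro t s z hz
      have hz' := hψS s z hz
      -- A time shift by `s` multiplies the clock by `e^s`; dividing the curve by `e^s` compensates,
      -- since `G` is scale invariant. Uniqueness then yields the group law.
      have hD : IsSecantSolution G Real.exp univ
          (fun t => Real.exp (-s) • Γ (z - zbar) (Real.exp (t + s) - 1)) := by
        intro t _
        have := hsec (z - zbar) (t + s) (mem_univ _)
        rw [nhdsWithin_univ] at this ⊢
        filter_upwards [(continuous_add_const s).continuousAt.eventually this] with r ⟨g, hg, e⟩
        refine ⟨g, ?_, ?_⟩
        · rw [hscale _ _ (Real.exp_pos _)]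
          exact hg
        · rw [← smul_sub, e, smul_smul]
          congr 1
          rw [mul_sub, ← Real.exp_add, ← Real.exp_add]
          ring_nf
      have := huniq (ψ s z - zbar) hz'.1 hz'.2 univ ordConnected_univ (mem_univ _) _ hD
        (by simp [ψ]) (mem_univ t)
      simp only at this
      simp only [ψ] at this ⊢
      rw [← this, smul_smul, ← Real.exp_add, neg_add]
    refine ⟨⟨fun t z => ⟨ψ t z, hψS t z z.2⟩, ?_, fun t s z => Subtype.ext (hψadd t s z z.2),
      fun z => Subtype.ext ?_⟩, fun z => ?_⟩
    · refine Continuous.subtype_mk (continuous_iff_continuousAt.2 fun p => ?_) _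
      have hc := continuousAt_solution hG hh h0 hΓ p.2.2.1 p.2.2.2 (Real.exp p.1 - 1)
      have hin : ContinuousAt (fun p : ℝ × S => (Real.exp p.1 - 1, (p.2 : E) - zbar)) p := by
        fun_prop
      have := ContinuousAt.comp (f := fun p : ℝ × S => (Real.exp p.1 - 1, (p.2 : E) - zbar)) hc hin
      have he : ContinuousAt (fun p : ℝ × S => Real.exp (-p.1)) p := by fun_prop
      exact continuousAt_const.add (he.smul this)
    · simp [ψ, h0]
    · exact isSolutionOn_of_isApproxSolution hG hscale hF (hΓ (z - zbar))

end Flow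

/-! ### Best responses as faces of the simplex -/

section BestResponse

variable {k : ℕ}

/-- Probability vectors maximizing the expected payoff when the pure strategies have payoffs
`a`. -/
def bestResp (a : Fin k → ℝ) : Set (Fin k → ℝ) :=
  {u ∈ stdSimplex ℝ (Fin k) | ∀ u' ∈ stdSimplex ℝ (Fin k), u' ⬝ᵥ a ≤ u ⬝ᵥ a}

open Classical in
/-- The indices at which `a` is maximal. -/
noncomputable def argmax (a : Fin k → ℝ) : Finset (Fin k) :=
  Finset.univ.filter fun i => ∀ j, a j ≤ a i

/-- The maximal entry of `a`. -/
noncomputable def topValue (a : Fin k → ℝ) : ℝ := ⨆ i, a i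

theorem mem_argmax {a : Fin k → ℝ} {i : Fin k} : i ∈ argmax a ↔ ∀ j, a j ≤ a i := by
  simp [argmax]

theorem le_topValue (a : Fin k → ℝ) (i : Fin k) : a i ≤ topValue a :=
  le_ciSup (Finite.bddAbove_range a) i

theorem eq_topValue {a : Fin k → ℝ} {i : Fin k} (hi : i ∈ argmax a) : a i = topValue a := by
  have : Nonempty (Fin k) := ⟨i⟩
  exact le_antisymm (le_topValue a i) (ciSup_le (mem_argmax.1 hi))

theorem argmax_nonempty [Nonempty (Fin k)] (a : Fin k → ℝ) : (argmax a).Nonempty := by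
  obtain ⟨i, hi⟩ := Finite.exists_max a
  exact ⟨i, mem_argmax.2 hi⟩

theorem continuous_topValue [Nonempty (Fin k)] : Continuous (topValue : (Fin k → ℝ) → ℝ) := by
  have : (topValue : (Fin k → ℝ) → ℝ) =
      fun a => Finset.univ.sup' Finset.univ_nonempty fun i => a i := by
    ext a
    rw [topValue, Finset.sup'_univ_eq_ciSup]
  rw [this]
  exact Continuous.finset_sup'_apply _ fun i _ => continuous_apply i

theorem topValue_smul {c : ℝ} (hc : 0 ≤ c) (a : Fin k → ℝ) :
    topValue (c • a) = c * topValue a :=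
  (Real.mul_iSup_of_nonneg hc a).symm

theorem argmax_smul {c : ℝ} (hc : 0 < c) (a : Fin k → ℝ) : argmax (c • a) = argmax a := by
  ext i
  simp [mem_argmax, hc]

theorem argmax_add_const (a : Fin k → ℝ) (c : ℝ) : argmax (a + fun _ => c) = argmax a := by
  ext i
  simp [mem_argmax]

theorem nonempty_of_mem_stdSimplex {u : Fin k → ℝ} (hu : u ∈ stdSimplex ℝ (Fin k)) :
    Nonempty (Fin k) := by
  rcases isEmpty_or_nonempty (Fin k) with h | h
  · exact absurd hu.2 (by simp)
  · exact h

theorem exists_ne_zero_of_mem_stdSimplex {u : Fin k → ℝ} (hu : u ∈ stdSimplex ℝ (Fin k)) :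
    ∃ i, u i ≠ 0 := by
  by_contra! h
  exact absurd hu.2 (by simp [h])

theorem dotProduct_le_of_mem_stdSimplex {u a : Fin k → ℝ} {v : ℝ}
    (hu : u ∈ stdSimplex ℝ (Fin k)) (ha : ∀ i, u i ≠ 0 → a i ≤ v) : u ⬝ᵥ a ≤ v := by
  calc u ⬝ᵥ a ≤ ∑ i, u i * v := Finset.sum_le_sum fun i _ => by
        rcases eq_or_ne (u i) 0 with h | h
        · simp [h]
        · exact mul_le_mul_of_nonneg_left (ha i h) (hu.1 i)
    _ = v := by rw [← Finset.sum_mul, hu.2, one_mul]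

theorem le_dotProduct_of_mem_stdSimplex {u a : Fin k → ℝ} {v : ℝ}
    (hu : u ∈ stdSimplex ℝ (Fin k)) (ha : ∀ i, u i ≠ 0 → v ≤ a i) : v ≤ u ⬝ᵥ a := by
  have := dotProduct_le_of_mem_stdSimplex (a := -a) (v := -v) hu fun i hi => neg_le_neg (ha i hi)
  rw [dotProduct_neg] at this
  linarith

theorem eq_of_dotProduct_le {u a : Fin k → ℝ} {v : ℝ}
    (hu : u ∈ stdSimplex ℝ (Fin k)) (ha : ∀ i, u i ≠ 0 → v ≤ a i) (hv : u ⬝ᵥ a ≤ v) :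
    ∀ i, u i ≠ 0 → a i = v := by
  have hnn : ∀ i ∈ Finset.univ, 0 ≤ u i * (a i - v) := fun i _ => by
    rcases eq_or_ne (u i) 0 with h | h
    · simp [h]
    · exact mul_nonneg (hu.1 i) (sub_nonneg.2 (ha i h))
  have hsum : ∑ i, u i * (a i - v) = u ⬝ᵥ a - v := by
    simp only [mul_sub, Finset.sum_sub_distrib, ← Finset.sum_mul, hu.2, one_mul, dotProduct]
  have hz := (Finset.sum_eq_zero_iff_of_nonneg hnn).1
    (le_antisymm (by rw [hsum]; linarith) (Finset.sum_nonneg hnn))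
  intro i hi
  have := (mul_eq_zero.1 (hz i (Finset.mem_univ i))).resolve_left hi
  linarith

theorem dotProduct_eq_of_mem_stdSimplex {u a : Fin k → ℝ} {v : ℝ}
    (hu : u ∈ stdSimplex ℝ (Fin k)) (ha : ∀ i, u i ≠ 0 → a i = v) : u ⬝ᵥ a = v :=
  le_antisymm (dotProduct_le_of_mem_stdSimplex hu fun i hi => (ha i hi).le)
    (le_dotProduct_of_mem_stdSimplex hu fun i hi => (ha i hi).ge)

theorem mem_bestResp_iff {a u : Fin k → ℝ} :
    u ∈ bestResp a ↔ u ∈ stdSimplex ℝ (Fin k) ∧ ∀ i, u i ≠ 0 → i ∈ argmax a := by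
  constructor
  · rintro ⟨hu, hmax⟩
    refine ⟨hu, fun i hi => mem_argmax.2 fun j => ?_⟩
    have : Nonempty (Fin k) := ⟨i⟩
    obtain ⟨l, hl⟩ := argmax_nonempty a
    have h1 := hmax _ (single_mem_stdSimplex ℝ l)
    rw [single_one_dotProduct] at h1
    have := eq_of_dotProduct_le (a := -a) (v := -a l) hu
      (fun i _ => neg_le_neg (mem_argmax.1 hl i)) (by rw [dotProduct_neg]; linarith) i hi
    rw [neg_inj.1 this]
    exact mem_argmax.1 hl j
  · rintro ⟨hu, hsupp⟩
    refine ⟨hu, fun u' hu' => ?_⟩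
    rw [dotProduct_eq_of_mem_stdSimplex hu fun i hi => eq_topValue (hsupp i hi)]
    exact dotProduct_le_of_mem_stdSimplex hu' fun i _ => le_topValue a i

theorem dotProduct_eq_topValue {a u : Fin k → ℝ} (hu : u ∈ bestResp a) : u ⬝ᵥ a = topValue a := by
  rw [mem_bestResp_iff] at hu
  exact dotProduct_eq_of_mem_stdSimplex hu.1 fun i hi => eq_topValue (hu.2 i hi)

theorem bestResp_nonempty [Nonempty (Fin k)] (a : Fin k → ℝ) : (bestResp a).Nonempty := by
  obtain ⟨i, hi⟩ := argmax_nonempty a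
  refine ⟨Pi.single i 1, mem_bestResp_iff.2 ⟨single_mem_stdSimplex ℝ i, fun j hj => ?_⟩⟩
  by_contra h
  exact hj (Pi.single_eq_of_ne (fun h' : j = i => h (h' ▸ hi)) _)

theorem convex_bestResp (a : Fin k → ℝ) : Convex ℝ (bestResp a) := by
  intro u hu w hw s t hs ht hst
  refine ⟨convex_stdSimplex ℝ _ hu.1 hw.1 hs ht hst, fun u' hu' => ?_⟩
  rw [add_dotProduct, smul_dotProduct, smul_dotProduct, smul_eq_mul, smul_eq_mul]
  have h1 := hu.2 u' hu'
  have h2 := hw.2 u' hu'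
  calc u' ⬝ᵥ a = s * (u' ⬝ᵥ a) + t * (u' ⬝ᵥ a) := by rw [← add_mul, hst, one_mul]
    _ ≤ _ := by gcongr

theorem isCompact_bestResp (a : Fin k → ℝ) : IsCompact (bestResp a) := by
  refine (isCompact_stdSimplex ℝ (Fin k)).of_isClosed_subset ?_ fun u hu => hu.1
  have : bestResp a = stdSimplex ℝ (Fin k) ∩ ⋂ u' ∈ stdSimplex ℝ (Fin k),
      {u | u' ⬝ᵥ a ≤ u ⬝ᵥ a} := by
    ext u
    simp [bestResp]
  rw [this]
  refine (isClosed_stdSimplex ℝ (Fin k)).inter (isClosed_biInter fun u' _ => ?_)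
  exact isClosed_le continuous_const (continuous_id.dotProduct continuous_const)

theorem bestResp_subset_of_argmax_subset {a b : Fin k → ℝ} (h : argmax a ⊆ argmax b) :
    bestResp a ⊆ bestResp b := by
  intro u hu
  rw [mem_bestResp_iff] at hu ⊢
  exact ⟨hu.1, fun i hi => h (hu.2 i hi)⟩

theorem bestResp_congr {a b : Fin k → ℝ} (h : argmax a = argmax b) : bestResp a = bestResp b :=
  (bestResp_subset_of_argmax_subset h.subset).antisymm
    (bestResp_subset_of_argmax_subset h.symm.subset)

/-- A strict inequality `a i < a j` persists nearby and there are finitely many indices. This is the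
source of `eventually_subset` for the velocities. -/
theorem eventually_argmax_subset (a : Fin k → ℝ) : ∀ᶠ b in 𝓝 a, argmax b ⊆ argmax a := by
  have : ∀ i, ∀ᶠ b : Fin k → ℝ in 𝓝 a, i ∈ argmax b → i ∈ argmax a := by
    intro i
    by_cases hi : i ∈ argmax a
    · exact .of_forall fun _ _ => hi
    · have : ∃ j, a i < a j := by
        rw [mem_argmax] at hi
        push Not at hi
        exact hi
      obtain ⟨j, hj⟩ := this
      filter_upwards [(continuous_apply i).continuousAt.eventually_lt
        (continuous_apply j).continuousAt hj] with b hb hib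
      exact absurd (mem_argmax.1 hib j) (not_le.2 hb)
  filter_upwards [eventually_all.2 this] with b hb i hi using hb i hi

theorem mem_face_iff {I : Finset (Fin k)} {w : Fin k → ℝ} :
    w ∈ face I ↔ w ∈ stdSimplex ℝ (Fin k) ∧ ∀ i, w i ≠ 0 → i ∈ I := by
  constructor
  · intro hw
    have hconv : Convex ℝ {w : Fin k → ℝ | w ∈ stdSimplex ℝ (Fin k) ∧ ∀ i, w i ≠ 0 → i ∈ I} := by
      intro u hu w hw s t hs ht hst
      refine ⟨convex_stdSimplex ℝ _ hu.1 hw.1 hs ht hst, fun i hi => ?_⟩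
      by_contra hiI
      exact hi (by simp [not_not.1 (mt (hu.2 i) hiI), not_not.1 (mt (hw.2 i) hiI)])
    refine convexHull_min ?_ hconv hw
    rintro _ ⟨i, hi, rfl⟩
    refine ⟨single_mem_stdSimplex ℝ i, fun j hj => ?_⟩
    by_contra h
    exact hj (Pi.single_eq_of_ne (fun h' : j = i => h (h' ▸ hi)) _)
  · rintro ⟨hw, hsupp⟩
    have hz : ∀ i, i ∉ I → w i = 0 := fun i hi => not_not.1 (mt (hsupp i) hi)
    have hsum : ∑ i ∈ I, w i • (Pi.single i (1 : ℝ) : Fin k → ℝ) = w := by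
      ext j
      rw [Finset.sum_apply]
      simp only [Pi.smul_apply, Pi.single_apply, smul_eq_mul, mul_ite, mul_one, mul_zero,
        Finset.sum_ite_eq]
      split_ifs with h
      · rfl
      · exact (hz j h).symm
    rw [← hsum]
    refine (convex_convexHull ℝ _).sum_mem (fun i _ => hw.1 i) ?_
      fun i hi => subset_convexHull ℝ _ ⟨i, hi, rfl⟩
    rw [← hw.2]
    exact Finset.sum_subset (Finset.subset_univ I) fun i _ hi => hz i hi

theorem bestResp_eq_face_iff {a : Fin k → ℝ} {I : Finset (Fin k)} :
    bestResp a = face I ↔ argmax a = I := by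
  constructor
  · intro h
    ext i
    have := Set.ext_iff.1 h (Pi.single i 1)
    rw [mem_bestResp_iff, mem_face_iff] at this
    have hs : ∀ J : Finset (Fin k),
        (∀ j, (Pi.single i 1 : Fin k → ℝ) j ≠ 0 → j ∈ J) ↔ i ∈ J := fun J => by
      constructor
      · intro h
        exact h i (by simp)
      · intro hi j hj
        by_contra h
        exact hj (Pi.single_eq_of_ne (fun h' : j = i => h (h' ▸ hi)) _)
    simpa only [hs, single_mem_stdSimplex, true_and] using this
  · rintro rfl
    ext u
    rw [mem_bestResp_iff, mem_face_iff]

theorem bestResp_eq_stdSimplex_iff {a : Fin k → ℝ} :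
    bestResp a = stdSimplex ℝ (Fin k) ↔ argmax a = Finset.univ := by
  have : stdSimplex ℝ (Fin k) = face Finset.univ := by
    ext u
    simp [mem_face_iff]
  rw [this, bestResp_eq_face_iff]

/-- Perturbing `a` in direction `d` selects the maximizers of `d` among those of `a`. -/
theorem eventually_argmax_add_smul {a d : Fin k → ℝ} {T : Finset (Fin k)} {v : ℝ}
    (hT : T.Nonempty) (hTa : T ⊆ argmax a) (hd : ∀ i ∈ argmax a, d i ≤ v)
    (hTd : ∀ i ∈ argmax a, i ∈ T ↔ d i = v) :
    ∀ᶠ η in 𝓝[>] (0 : ℝ), argmax (a + η • d) = T := by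
  obtain ⟨l, hl⟩ := hT
  have hla := hTa hl
  have hld := (hTd l hla).1 hl
  have hout : ∀ j, ∀ᶠ η in 𝓝[>] (0 : ℝ), j ∉ argmax a → a j + η * d j < a l + η * d l := by
    intro j
    by_cases hj : j ∈ argmax a
    · exact .of_forall fun _ h => absurd hj h
    · have hlt : a j < a l := by
        refine lt_of_le_of_ne (mem_argmax.1 hla j) fun h => hj (mem_argmax.2 fun i => ?_)
        rw [h]
        exact mem_argmax.1 hla i
      have h1 : Continuous fun η : ℝ => a j + η * d j := by fun_prop
      have h2 : Continuous fun η : ℝ => a l + η * d l := by fun_prop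
      filter_upwards [mem_nhdsWithin_of_mem_nhds (h1.continuousAt.eventually_lt h2.continuousAt
        (x₀ := 0) (by simpa using hlt))] with η hη _ using hη
  filter_upwards [eventually_all.2 hout, self_mem_nhdsWithin] with η hη hpos
  have hpos : 0 < η := hpos
  have heq : ∀ i ∈ argmax a, a i = a l := fun i hi => (eq_topValue hi).trans (eq_topValue hla).symm
  have hle : ∀ j, a j + η * d j ≤ a l + η * d l := by
    intro j
    by_cases hj : j ∈ argmax a
    · rw [heq j hj, hld]
      have := hd j hj
      gcongr
    · exact (hη j hj).le
  ext i
  simp only [mem_argmax, Pi.add_apply, Pi.smul_apply, smul_eq_mul]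
  constructor
  · intro h
    have hia : i ∈ argmax a := by
      by_contra hi
      exact absurd (h l) (not_le.2 (hη i hi))
    refine (hTd i hia).2 (le_antisymm (hd i hia) ?_)
    have := h l
    rw [heq i hia, hld, add_le_add_iff_left] at this
    exact le_of_mul_le_mul_left this hpos
  · intro hi j
    have hia := hTa hi
    rw [heq i hia, (hTd i hia).1 hi, ← hld]
    exact hle j

end BestResponse

/-! ### Consequences of the transversality assumptions -/

section Transversality

variable {m n : ℕ} {M : Matrix (Fin m) (Fin n) ℝ}

theorem mem_hyperplane {k : ℕ} {x : Fin k → ℝ} : x ∈ hyperplane k ↔ ∑ i, x i = 1 := Iff.rfl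

theorem sum_orderEmbOfFin {k r : ℕ} {S : Finset (Fin k)} (hr : S.card = r) (f : Fin k → ℝ) :
    ∑ l, f (S.orderEmbOfFin hr l) = ∑ i ∈ S, f i := by
  have : S = Finset.univ.map (S.orderEmbOfFin hr).toEmbedding := by
    ext i
    simp
  conv_rhs => rw [this, Finset.sum_map]
  rfl

theorem sum_eq_sum_of_support {k : ℕ} {S : Finset (Fin k)} {f : Fin k → ℝ}
    (hf : ∀ i, i ∉ S → f i = 0) : ∑ i, f i = ∑ i ∈ S, f i :=
  (Finset.sum_subset (Finset.subset_univ S) fun i _ hi => hf i hi).symm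

theorem FirstTransversality.neg_transpose (hM : FirstTransversality M) :
    FirstTransversality (-Mᵀ) := by
  intro r hr f g h
  have : (-Mᵀ).submatrix f g = -(M.submatrix g f)ᵀ := rfl
  rw [this, det_neg, det_transpose, mul_eq_zero] at h
  exact h.elim (fun h => by simp at h) (hM r hr g f)

/-- For at least two rows a square minor on the rows `S` is invertible. With at most one row minors
give no information, and the zero coordinate sum takes over. -/
theorem FirstTransversality.eq_zero_of_vecMul_eq_zero (hM : FirstTransversality M)
    {S : Finset (Fin m)} (hS : S.card ≤ n) {x : Fin m → ℝ} (hx : ∀ i, i ∉ S → x i = 0)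
    (hsum : ∑ i, x i = 0) (hxM : x ᵥ* M = 0) : x = 0 := by
  rcases lt_or_ge S.card 2 with hc | hc
  · ext i
    by_cases hi : i ∈ S
    · have hS1 : S = {i} := by
        refine (Finset.eq_of_subset_of_card_le (Finset.singleton_subset_iff.2 hi) ?_).symm
        rw [Finset.card_singleton]
        omega
      rw [sum_eq_sum_of_support hx, hS1, Finset.sum_singleton] at hsum
      exact hsum
    · exact hx i hi
  · have hdet := hM S.card hc (S.orderEmbOfFin rfl) (Fin.castLEOrderEmb hS)
    have hv : (fun l => x (S.orderEmbOfFin rfl l)) ᵥ*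
        M.submatrix (S.orderEmbOfFin rfl) (Fin.castLEOrderEmb hS) = 0 := by
      ext j
      have h1 := congrFun hxM (Fin.castLEOrderEmb hS j)
      rw [vecMul, dotProduct, sum_eq_sum_of_support (S := S) fun i hi => by rw [hx i hi, zero_mul],
        ← sum_orderEmbOfFin rfl] at h1
      exact h1
    have hz := Matrix.eq_zero_of_vecMul_eq_zero hdet hv
    ext i
    by_cases hi : i ∈ S
    · have : i ∈ Set.range (S.orderEmbOfFin rfl) := by
        rw [Finset.range_orderEmbOfFin]
        exact hi
      obtain ⟨l, rfl⟩ := this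
      exact congrFun hz l
    · exact hx i hi

theorem FirstTransversality.eq_zero_of_mulVec_eq_const (hM : FirstTransversality M)
    {S : Finset (Fin m)} (hS : S.card = n) {qbar : Fin n → ℝ} (hq : ∑ j, qbar j = 1) {c : ℝ}
    (hc : M *ᵥ qbar = fun _ => c) {x : Fin n → ℝ} (hx : ∑ j, x j = 0) {κ : ℝ}
    (hκ : ∀ i ∈ S, (M *ᵥ x) i = κ) : x = 0 := by
  rcases lt_or_ge n 2 with hn | hn
  · ext j
    have : Subsingleton (Fin n) := Fin.subsingleton_iff_le_one.2 (by omega)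
    rw [Fintype.sum_subsingleton _ j] at hx
    exact hx
  · have hdet := hM n hn (S.orderEmbOfFin hS) (RelEmbedding.refl _)
    have hker : ∀ y : Fin n → ℝ, (∀ i ∈ S, (M *ᵥ y) i = 0) → y = 0 := fun y hy =>
      eq_zero_of_mulVec_eq_zero hdet (funext fun l => hy _ (S.orderEmbOfFin_mem hS l))
    -- This combination has equal payoffs cancelled on `S`, so it vanishes; its coordinate sum is
    -- `-κ`, which forces `κ = 0`.
    have hy := hker (c • x - κ • qbar) fun i hi => by
      simp [mulVec_sub, mulVec_smul, hκ i hi, hc, mul_comm]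
    have hsum : ∑ j, (c • x - κ • qbar) j = -κ := by
      simp [Finset.sum_sub_distrib, ← Finset.mul_sum, hx, hq]
    have hκ0 : κ = 0 := by
      rw [hy] at hsum
      simpa using hsum.symm
    exact hker x fun i hi => (hκ i hi).trans hκ0

/-- If fewer than `n` linear conditions are imposed on `S`, with `n` elements, there is a nonzero
vector on `S` with coordinate sum zero that satisfies all but one of them. -/
theorem exists_ne_zero_of_card_lt {S : Finset (Fin m)} {J : Finset (Fin n)} (hJS : J.card < S.card)
    (L : Matrix (Fin m) (Fin n) ℝ) {j₀ : Fin n} (hj₀ : j₀ ∈ J) :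
    ∃ x : Fin m → ℝ, x ≠ 0 ∧ (∀ i, i ∉ S → x i = 0) ∧ ∑ i, x i = 0 ∧
      ∀ j ∈ J, j ≠ j₀ → (x ᵥ* L) j = 0 := by
  classical
  -- The slot of `j₀` is given to the coordinate sum, so the number of conditions is `(m - |S|) +
  -- |J| < m`.
  let f : (Fin m → ℝ) →ₗ[ℝ] ({i // i ∉ S} → ℝ) × (J → ℝ) :=
    (LinearMap.pi fun i : {i // i ∉ S} => LinearMap.proj (i : Fin m)).prod
      (LinearMap.pi fun j : J => if (j : Fin n) = j₀ then ∑ i, LinearMap.proj i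
        else LinearMap.proj (j : Fin n) ∘ₗ L.vecMulLinear)
  have hlt : Module.finrank ℝ (({i // i ∉ S} → ℝ) × (J → ℝ)) < Module.finrank ℝ (Fin m → ℝ) := by
    rw [Module.finrank_prod, Module.finrank_fintype_fun_eq_card,
      Module.finrank_fintype_fun_eq_card, Module.finrank_fintype_fun_eq_card,
      Fintype.card_subtype_compl, Fintype.card_coe, Fintype.card_coe, Fintype.card_fin]
    have : S.card ≤ m := by simpa using S.card_le_univ
    omega
  obtain ⟨x, hx, hx0⟩ :=
    (Submodule.ne_bot_iff _).1 (LinearMap.ker_ne_bot_of_finrank_lt (f := f) hlt)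
  rw [LinearMap.mem_ker] at hx
  have h1 := congrArg Prod.fst hx
  have h2 := congrArg Prod.snd hx
  refine ⟨x, hx0, fun i hi => congrFun h1 ⟨i, hi⟩, ?_, fun j hj hne => ?_⟩
  · have := congrFun h2 ⟨j₀, hj₀⟩
    simpa [f] using this
  · have := congrFun h2 ⟨j, hj⟩
    simpa [f, hne] using this

theorem mem_indiffQ_iff {q : Fin n → ℝ} {I : Finset (Fin m)} :
    q ∈ indiffQ M I ↔ q ∈ stdSimplex ℝ (Fin n) ∧ argmax (M *ᵥ q) = I :=
  and_congr_right fun _ => bestResp_eq_face_iff (a := M *ᵥ q)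

theorem eventually_pos_add_smul {k : ℕ} {p : Fin k → ℝ} (hp : ∀ i, 0 < p i) (x : Fin k → ℝ) :
    ∀ᶠ s in 𝓝[>] (0 : ℝ), ∀ i, 0 < (p + s • x) i := by
  refine eventually_all.2 fun i => ?_
  have hc : Continuous fun s : ℝ => (p + s • x) i := by
    simp only [Pi.add_apply, Pi.smul_apply, smul_eq_mul]
    fun_prop
  exact mem_nhdsWithin_of_mem_nhds
    ((continuousAt_const (y := (0 : ℝ))).eventually_lt (x₀ := (0 : ℝ)) hc.continuousAt
      (by simpa using hp i))

/-- The affine span of a nonempty indifference set contains every point of the hyperplane at which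
the strategies in question have equal payoffs. -/
theorem mem_affineSpan_indiffQ {qbar : Fin n → ℝ} (hqpos : ∀ j, 0 < qbar j)
    (hq : ∑ j, qbar j = 1) {c : ℝ} (hc : M *ᵥ qbar = fun _ => c) {T : Finset (Fin m)}
    (hT : T.Nonempty) {x : Fin n → ℝ} (hx : ∑ j, x j = 0) (hxT : argmax (M *ᵥ x) = T)
    {r : Fin n → ℝ} (hr : ∑ j, r j = 1) {v : ℝ} (hrT : ∀ i ∈ T, (M *ᵥ r) i = v) :
    r ∈ affineSpan ℝ (indiffQ M T) := by
  -- As `qbar` is positive and equalizing, a small step along `x` stays in the simplex and has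
  -- maximal set `T`.
  obtain ⟨s, hs, hspos⟩ := ((eventually_pos_add_smul hqpos x).and self_mem_nhdsWithin).exists
  have hspos : 0 < s := hspos
  set p := qbar + s • x with hp
  have hpsum : ∑ j, p j = 1 := by
    simp [hp, Finset.sum_add_distrib, ← Finset.mul_sum, hx, hq]
  have hpT : argmax (M *ᵥ p) = T := by
    rw [hp, mulVec_add, mulVec_smul, hc, add_comm, argmax_add_const, argmax_smul hspos, hxT]
  have hpmem : p ∈ indiffQ M T := mem_indiffQ_iff.2 ⟨⟨fun j => (hs j).le, hpsum⟩, hpT⟩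
  obtain ⟨l, hl⟩ := hT
  have hd : ∀ i ∈ argmax (M *ᵥ p), (M *ᵥ (r - p)) i = v - topValue (M *ᵥ p) := fun i hi => by
    rw [mulVec_sub, Pi.sub_apply, hrT i (hpT ▸ hi), eq_topValue hi]
  -- A small step from `p` towards `r` keeps the payoffs on `T` equal and maximal. The line through
  -- both points reaches `r` at parameter `η⁻¹`.
  obtain ⟨η, ⟨h1, h2⟩, hηpos⟩ := (((eventually_pos_add_smul hs (r - p)).and
    (eventually_argmax_add_smul ⟨l, hl⟩ hpT.symm.subset (fun i hi => (hd i hi).le)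
      fun i hi => iff_of_true (hpT ▸ hi) (hd i hi))).and self_mem_nhdsWithin).exists
  have hηpos : 0 < η := hηpos
  have hp' : p + η • (r - p) ∈ indiffQ M T := by
    refine mem_indiffQ_iff.2 ⟨⟨fun j => (h1 j).le, ?_⟩, ?_⟩
    · simp [Finset.sum_add_distrib, ← Finset.mul_sum, Finset.sum_sub_distrib, hpsum, hr]
    · rw [mulVec_add, mulVec_smul, h2]
  have := AffineMap.lineMap_mem η⁻¹ (subset_affineSpan ℝ _ hpmem) (subset_affineSpan ℝ _ hp')
  rw [AffineMap.lineMap_apply, vsub_eq_sub, add_sub_cancel_left, inv_smul_smul₀ hηpos.ne',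
    vadd_eq_add, sub_add_cancel] at this
  exact this

theorem mem_targetSpan {k : ℕ} {Y : Matrix (Fin k) (Fin k) ℝ} {α : ℝ} {c w : Fin k → ℝ}
    {J : Finset (Fin k)} (hw : w ∈ face J) : Y *ᵥ w + α • c ∈ targetSpan Y α c J := by
  let f : (Fin k → ℝ) →ᵃ[ℝ] (Fin k → ℝ) :=
    Y.mulVecLin.toAffineMap + AffineMap.const ℝ (Fin k → ℝ) (α • c)
  have h1 : f w ∈ (affineSpan ℝ ((fun i => Pi.single i (1 : ℝ)) '' (J : Set (Fin k)))).map f :=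
    AffineSubspace.mem_map_of_mem f (convexHull_subset_affineSpan _ hw)
  rw [AffineSubspace.map_span, ← image_comp] at h1
  exact h1

/-- General position forces a vector on `T` with coordinate sum zero into the left kernel of `M`
when it pairs to zero with all targets. -/
theorem vecMul_eq_zero_of_generalPosition {Y : Matrix (Fin n) (Fin n) ℝ} {α : ℝ}
    {qbar : Fin n → ℝ} {c : ℝ} (hc : M *ᵥ qbar = fun _ => c) {T : Finset (Fin m)}
    {J : Finset (Fin n)}
    (hgp : GeneralPosition (hyperplane n) (affineSpan ℝ (indiffQ M T)) (targetSpan Y α qbar J))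
    {r : Fin n → ℝ} (hr : r ∈ affineSpan ℝ (indiffQ M T)) (hr' : r ∈ targetSpan Y α qbar J)
    {x : Fin m → ℝ} (hx : ∀ i, i ∉ T → x i = 0) (hsum : ∑ i, x i = 0)
    (hxJ : ∀ j ∈ J, (x ᵥ* (M * Y)) j = 0) : x ᵥ* M = 0 := by
  have hconst : ∀ (a : Fin m → ℝ) (v : ℝ), (∀ i ∈ T, a i = v) → x ⬝ᵥ a = 0 := by
    intro a v ha
    calc x ⬝ᵥ a = ∑ i, x i * v := Finset.sum_congr rfl fun i _ => by
          by_cases hi : i ∈ T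
          · rw [ha i hi]
          · rw [hx i hi, zero_mul, zero_mul]
      _ = 0 := by rw [← Finset.sum_mul, hsum, zero_mul]
  rcases hgp with h | h
  · have : r ∈ affineSpan ℝ (indiffQ M T) ⊓ targetSpan Y α qbar J := ⟨hr, hr'⟩
    rw [h] at this
    exact absurd this (AffineSubspace.notMem_bot ℝ _ r)
  -- The functional `q ↦ x M q` vanishes on the indifference set, where `M q` is constant on `T`,
  -- and on the targets. It then vanishes on the whole hyperplane, which contains the unit vectors.
  · let ℓ : (Fin n → ℝ) →ₗ[ℝ] ℝ := dotProductBilin ℝ ℝ (x ᵥ* M)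
    have hℓ : ∀ q, ℓ q = x ⬝ᵥ (M *ᵥ q) := fun q => (dotProduct_mulVec x M q).symm
    have hle : hyperplane n ≤ (LinearMap.ker ℓ).toAffineSubspace := by
      rw [← h]
      refine sup_le (affineSpan_le.2 fun q hq => ?_) (affineSpan_le.2 ?_)
      · rw [mem_indiffQ_iff] at hq
        change ℓ q = 0
        rw [hℓ]
        exact hconst _ (topValue (M *ᵥ q)) fun i hi => eq_topValue (hq.2 ▸ hi)
      · rintro _ ⟨j, hj, rfl⟩
        change ℓ _ = 0
        have h1 := hxJ j hj
        rw [hℓ, mulVec_add, dotProduct_add, mulVec_smul, dotProduct_smul, hc,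
          hconst (fun _ => c) c fun _ _ => rfl, mulVec_mulVec, dotProduct_mulVec,
          dotProduct_single_one, h1, smul_zero, add_zero]
    ext j
    have hj : (Pi.single j 1 : Fin n → ℝ) ∈ hyperplane n := by
      rw [mem_hyperplane]
      simp
    have : ℓ (Pi.single j 1) = 0 := hle hj
    rw [hℓ, dotProduct_mulVec, dotProduct_single_one] at this
    exact this

/-- Two optimal strategies of the local game at a state coincide, unless the opponent's optimal
strategy has full support and the opponent's state is the equilibrium. -/
theorem eq_or_full_support (hM : FirstTransversality M) {Y : Matrix (Fin n) (Fin n) ℝ} {α : ℝ}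
    {qbar : Fin n → ℝ} (hqpos : ∀ j, 0 < qbar j) (hq : ∑ j, qbar j = 1) {c : ℝ}
    (hc : M *ᵥ qbar = fun _ => c)
    (hlevel : ∀ q ∈ stdSimplex ℝ (Fin n), Y *ᵥ q + α • qbar ∈ hyperplane n)
    (hgp : ∀ (T : Finset (Fin m)) (J : Finset (Fin n)), T.Nonempty → J.Nonempty →
      GeneralPosition (hyperplane n) (affineSpan ℝ (indiffQ M T)) (targetSpan Y α qbar J))
    {x : Fin n → ℝ} (hx : ∑ j, x j = 0) {s v : ℝ} (hs : s ≠ 0) {w : Fin n → ℝ}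
    (hw : w ∈ stdSimplex ℝ (Fin n))
    (hwv : ∀ i ∈ argmax (M *ᵥ x), s * ((M * Y) *ᵥ w) i ≤ v)
    {u₁ u₂ : Fin m → ℝ} (h₁ : u₁ ∈ bestResp (M *ᵥ x)) (h₂ : u₂ ∈ bestResp (M *ᵥ x))
    (h₁w : ∀ i, u₁ i ≠ 0 → s * ((M * Y) *ᵥ w) i = v)
    (h₂w : ∀ i, u₂ i ≠ 0 → s * ((M * Y) *ᵥ w) i = v)
    (h₁v : ∀ j, w j ≠ 0 → s * (u₁ ᵥ* (M * Y)) j = v)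
    (h₂v : ∀ j, w j ≠ 0 → s * (u₂ ᵥ* (M * Y)) j = v) :
    u₁ = u₂ ∨ ((∀ j, w j ≠ 0) ∧ x = 0) := by
  classical
  rw [mem_bestResp_iff] at h₁ h₂
  set L := M * Y with hL
  set T := (argmax (M *ᵥ x)).filter fun i => s * (L *ᵥ w) i = v with hT
  set J : Finset (Fin n) := Finset.univ.filter fun j => w j ≠ 0 with hJ
  have hJmem : ∀ j, j ∈ J ↔ w j ≠ 0 := by simp [hJ]
  have hTmem : ∀ i, i ∈ T ↔ i ∈ argmax (M *ᵥ x) ∧ s * (L *ᵥ w) i = v := by simp [hT]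
  have hT₁ : ∀ i, u₁ i ≠ 0 → i ∈ T := fun i hi => (hTmem i).2 ⟨h₁.2 i hi, h₁w i hi⟩
  have hT₂ : ∀ i, u₂ i ≠ 0 → i ∈ T := fun i hi => (hTmem i).2 ⟨h₂.2 i hi, h₂w i hi⟩
  have hTne : T.Nonempty := by
    obtain ⟨i, hi⟩ := exists_ne_zero_of_mem_stdSimplex h₁.1
    exact ⟨i, hT₁ i hi⟩
  obtain ⟨j₀, hj₀⟩ := exists_ne_zero_of_mem_stdSimplex hw
  have hJne : J.Nonempty := ⟨j₀, (hJmem j₀).2 hj₀⟩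
  -- The target `r` of `w` lies in both affine spans, which excludes the disjoint case of general
  -- position.
  set r := Y *ᵥ w + α • qbar with hr
  have hrsum : ∑ j, r j = 1 := hlevel w hw
  have hMr : M *ᵥ r = L *ᵥ w + fun _ => α * c := by
    rw [hr, mulVec_add, mulVec_smul, hc, mulVec_mulVec, hL]
    rfl
  have hLT : ∀ i ∈ T, (L *ᵥ w) i = v / s := fun i hi => by
    rw [eq_div_iff hs, mul_comm]
    exact ((hTmem i).1 hi).2
  -- Moving `x` slightly along `s • (r - qbar)` makes `T` exactly the maximal set, as the affine
  -- span of the indifference set requires.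
  obtain ⟨η, hη, hηpos⟩ := ((eventually_argmax_add_smul (a := M *ᵥ x) (d := s • (L *ᵥ w)) (v := v)
    hTne (Finset.filter_subset _ _) hwv fun i hi => by simp [hTmem, hi]).and
      self_mem_nhdsWithin).exists
  have hxT : argmax (M *ᵥ (x + η • s • (r - qbar))) = T := by
    have : M *ᵥ (x + η • s • (r - qbar)) =
        (M *ᵥ x + η • s • (L *ᵥ w)) + fun _ => η * (s * (α * c - c)) := by
      rw [mulVec_add, mulVec_smul, mulVec_smul, mulVec_sub, hMr, hc]
      ext i
      simp only [Pi.add_apply, Pi.smul_apply, Pi.sub_apply, smul_eq_mul]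
      ring
    rw [this, argmax_add_const, hη]
  have hxsum : ∑ j, (x + η • s • (r - qbar)) j = 0 := by
    simp [Finset.sum_add_distrib, ← Finset.mul_sum, Finset.sum_sub_distrib, hrsum, hq, hx]
  have hrspan : r ∈ affineSpan ℝ (indiffQ M T) :=
    mem_affineSpan_indiffQ hqpos hq hc hTne hxsum hxT hrsum (v := v / s + α * c) fun i hi => by
      rw [hMr, Pi.add_apply, hLT i hi]
  have hrtarget : r ∈ targetSpan Y α qbar J :=
    mem_targetSpan (mem_face_iff.2 ⟨hw, fun j hj => (hJmem j).2 hj⟩)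
  have key : ∀ y : Fin m → ℝ, (∀ i, i ∉ T → y i = 0) → ∑ i, y i = 0 →
      (∀ j ∈ J, (y ᵥ* L) j = 0) → y ᵥ* M = 0 := fun y hy hy0 hyJ =>
    vecMul_eq_zero_of_generalPosition hc (hgp T J hTne hJne) hrspan hrtarget hy hy0 hyJ
  rcases le_or_gt T.card n with hcard | hcard
  · left
    have hz : ∀ i, i ∉ T → (u₁ - u₂) i = 0 := fun i hi => by
      simp [not_not.1 (mt (hT₁ i) hi), not_not.1 (mt (hT₂ i) hi)]
    have hsum : ∑ i, (u₁ - u₂) i = 0 := by simp [Finset.sum_sub_distrib, h₁.1.2, h₂.1.2]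
    refine sub_eq_zero.1 (hM.eq_zero_of_vecMul_eq_zero hcard hz hsum (key _ hz hsum fun j hj => ?_))
    have hj := (hJmem j).1 hj
    rw [sub_vecMul, Pi.sub_apply, sub_eq_zero]
    exact mul_left_cancel₀ hs ((h₁v j hj).trans (h₂v j hj).symm)
  · right
    -- With more than `n` strategies in `T`, some `n` of them form `S`. Were the support of `w`
    -- smaller than `n`, a dimension count would give a nonzero vector on `S` in the left kernel of
    -- `M`.
    obtain ⟨S, hST, hSn⟩ := Finset.exists_subset_card_eq hcard.le
    constructor
    · have hJn : n ≤ J.card := by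
        by_contra! hlt
        obtain ⟨y, hy0, hyS, hysum, hyJ⟩ := exists_ne_zero_of_card_lt (hlt.trans_eq hSn.symm) L
          ((hJmem j₀).2 hj₀)
        have hyT : ∀ i, i ∉ T → y i = 0 := fun i hi => hyS i fun h => hi (hST h)
        refine hy0 (hM.eq_zero_of_vecMul_eq_zero hSn.le hyS hysum
          (key y hyT hysum fun j hj => ?_))
        -- The omitted condition at `j₀` follows from `y L w = 0`: `L w` is constant on `T`, the
        -- other terms vanish, and `w j₀ ≠ 0`.
        rcases eq_or_ne j j₀ with rfl | hne
        · have h1 : (y ᵥ* L) ⬝ᵥ w = 0 := by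
            rw [← dotProduct_mulVec]
            calc y ⬝ᵥ (L *ᵥ w) = ∑ i, y i * (v / s) := Finset.sum_congr rfl fun i _ => by
                  by_cases hi : i ∈ T
                  · rw [hLT i hi]
                  · rw [hyT i hi, zero_mul, zero_mul]
              _ = 0 := by rw [← Finset.sum_mul, hysum, zero_mul]
          rw [dotProduct, Finset.sum_eq_single j] at h1
          · exact (mul_eq_zero.1 h1).resolve_right hj₀
          · intro l _ hlj
            by_cases hl : w l = 0
            · rw [hl, mul_zero]
            · rw [hyJ l ((hJmem l).2 hl) hlj, zero_mul]
          · simp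
        · exact hyJ j hj hne
      intro j
      have : J = Finset.univ := Finset.eq_univ_of_card J
        (le_antisymm (by simpa using J.card_le_univ) (by simpa using hJn))
      exact (hJmem j).1 (this ▸ Finset.mem_univ j)
    · exact hM.eq_zero_of_mulVec_eq_const hSn hq hc hx (κ := topValue (M *ᵥ x)) fun i hi =>
        eq_topValue ((hTmem i).1 (hST hi)).1

end Transversality

/-! ### The rescaled game dynamics and the conserved gap -/

section Game

variable {m n : ℕ} {M : Matrix (Fin m) (Fin n) ℝ} {X : Matrix (Fin m) (Fin m) ℝ}
  {Y : Matrix (Fin n) (Fin n) ℝ} {α c : ℝ} {pbar : Fin m → ℝ} {qbar : Fin n → ℝ}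

/-- Strictly positive probability vectors that make the opponent indifferent, with value `c`. -/
structure IsEqualizing (M : Matrix (Fin m) (Fin n) ℝ) (pbar : Fin m → ℝ) (qbar : Fin n → ℝ)
    (c : ℝ) : Prop where
  pos_left : ∀ i, 0 < pbar i
  sum_left : ∑ i, pbar i = 1
  pos_right : ∀ j, 0 < qbar j
  sum_right : ∑ j, qbar j = 1
  mulVec_right : M *ᵥ qbar = fun _ => c
  mulVec_left : (-Mᵀ) *ᵥ pbar = fun _ => -c

/-- The tangent space of the phase space. -/
def tangentSpace (m n : ℕ) : Submodule ℝ ((Fin m → ℝ) × (Fin n → ℝ)) where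
  carrier := {x | ∑ i, x.1 i = 0 ∧ ∑ j, x.2 j = 0}
  add_mem' := by
    rintro x y ⟨h1, h2⟩ ⟨h3, h4⟩
    simp [Finset.sum_add_distrib, h1, h2, h3, h4]
  zero_mem' := by simp
  smul_mem' := by
    rintro c x ⟨h1, h2⟩
    simp [← Finset.mul_sum, h1, h2]

theorem mem_tangentSpace {x : (Fin m → ℝ) × (Fin n → ℝ)} :
    x ∈ tangentSpace m n ↔ ∑ i, x.1 i = 0 ∧ ∑ j, x.2 j = 0 := Iff.rfl

/-- The velocities of the rescaled displacement from the equilibrium. -/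
def velocities (M : Matrix (Fin m) (Fin n) ℝ) (X : Matrix (Fin m) (Fin m) ℝ)
    (Y : Matrix (Fin n) (Fin n) ℝ) (α : ℝ) (pbar : Fin m → ℝ) (qbar : Fin n → ℝ)
    (x : (Fin m → ℝ) × (Fin n → ℝ)) : Set ((Fin m → ℝ) × (Fin n → ℝ)) :=
  (fun s => (X *ᵥ s.1 + (α - 1) • pbar, Y *ᵥ s.2 + (α - 1) • qbar)) ''
    (bestResp (M *ᵥ x.2) ×ˢ bestResp ((-Mᵀ) *ᵥ x.1))

/-- The difference of the values that the two players can secure by best responses to a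
displacement from the equilibrium. -/
noncomputable def gap (M : Matrix (Fin m) (Fin n) ℝ) (x : (Fin m → ℝ) × (Fin n → ℝ)) : ℝ :=
  topValue (M *ᵥ x.2) + topValue ((-Mᵀ) *ᵥ x.1)

theorem neg_transpose_mulVec (L : Matrix (Fin m) (Fin n) ℝ) (u : Fin m → ℝ) :
    (-Lᵀ) *ᵥ u = -(u ᵥ* L) := by
  rw [neg_mulVec, mulVec_transpose]

theorem brP_eq_bestResp (M : Matrix (Fin m) (Fin n) ℝ) (q : Fin n → ℝ) :
    brP M q = bestResp (M *ᵥ q) := rfl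

theorem brQ_eq_bestResp (M : Matrix (Fin m) (Fin n) ℝ) (p : Fin m → ℝ) :
    brQ M p = bestResp ((-Mᵀ) *ᵥ p) := by
  have h : ∀ q, q ⬝ᵥ ((-Mᵀ) *ᵥ p) = -(p ⬝ᵥ (M *ᵥ q)) := fun q => by
    rw [neg_transpose_mulVec, dotProduct_neg, dotProduct_comm, ← dotProduct_mulVec]
  ext q
  simp only [brQ, bestResp, mem_ofPred_eq, h, neg_le_neg_iff]

theorem indiffP_eq (M : Matrix (Fin m) (Fin n) ℝ) (J : Finset (Fin n)) :
    indiffP M J = indiffQ (-Mᵀ) J := by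
  ext p
  simp only [indiffP, indiffQ, brQ_eq_bestResp, brP_eq_bestResp]

theorem eq_const_of_mem_bestResp {k : ℕ} {a u : Fin k → ℝ} (hu : u ∈ bestResp a)
    (hpos : ∀ i, 0 < u i) : a = fun _ => topValue a :=
  funext fun i => eq_topValue ((mem_bestResp_iff.1 hu).2 i (hpos i).ne')

/-- A best response of full support makes all payoffs maximal, hence equal. Both constants are, up
to sign, the value `pbar M qbar`. -/
theorem IsCompletelyMixedNash.isEqualizing (h : IsCompletelyMixedNash M pbar qbar) :
    ∃ c, IsEqualizing M pbar qbar c := by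
  obtain ⟨⟨hp, hq⟩, hppos, hqpos⟩ := h
  have hM := eq_const_of_mem_bestResp hp hppos
  rw [brQ_eq_bestResp] at hq
  have hM' := eq_const_of_mem_bestResp hq hqpos
  refine ⟨_, hppos, hp.1.2, hqpos, hq.1.2, hM, ?_⟩
  rw [hM']
  ext
  rw [← dotProduct_eq_topValue hq, ← dotProduct_eq_topValue hp, neg_transpose_mulVec,
    dotProduct_neg, dotProduct_comm, ← dotProduct_mulVec]

/-- Exchanging the players replaces `M` by `-Mᵀ`, so facts need proof for one player only. -/
theorem IsEqualizing.swap (h : IsEqualizing M pbar qbar c) :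
    IsEqualizing (-Mᵀ) qbar pbar (-c) := by
  refine ⟨h.pos_right, h.sum_right, h.pos_left, h.sum_left, h.mulVec_left, ?_⟩
  rw [transpose_neg, transpose_transpose, neg_neg, neg_neg]
  exact h.mulVec_right

theorem IsEqualizing.dotProduct_mulVec_eq_zero (h : IsEqualizing M pbar qbar c) {y : Fin n → ℝ}
    (hy : ∑ j, y j = 0) : pbar ⬝ᵥ (M *ᵥ y) = 0 := by
  have : pbar ᵥ* M = fun _ => c := by
    rw [← neg_neg (pbar ᵥ* M), ← neg_transpose_mulVec, h.mulVec_left]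
    ext
    simp
  rw [dotProduct_mulVec, this, dotProduct, ← Finset.mul_sum, hy, mul_zero]

theorem IsEqualizing.mem_stdSimplex (h : IsEqualizing M pbar qbar c) :
    pbar ∈ stdSimplex ℝ (Fin m) :=
  ⟨fun i => (h.pos_left i).le, h.sum_left⟩

/-- The average of `M y` with weights `pbar` is zero for tangent `y`. Positivity of these weights
also makes a zero maximum force all entries to vanish. -/
theorem IsEqualizing.topValue_nonneg (h : IsEqualizing M pbar qbar c) {y : Fin n → ℝ}
    (hy : ∑ j, y j = 0) : 0 ≤ topValue (M *ᵥ y) := by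
  rw [← h.dotProduct_mulVec_eq_zero hy]
  exact dotProduct_le_of_mem_stdSimplex h.mem_stdSimplex fun i _ => le_topValue _ i

theorem IsEqualizing.topValue_eq_zero_iff (h : IsEqualizing M pbar qbar c) {y : Fin n → ℝ}
    (hy : ∑ j, y j = 0) : topValue (M *ᵥ y) = 0 ↔ argmax (M *ᵥ y) = Finset.univ := by
  constructor
  · intro h0
    have := eq_of_dotProduct_le (a := -(M *ᵥ y)) (v := 0) h.mem_stdSimplex
      (fun i _ => by simpa [h0] using le_topValue (M *ᵥ y) i)
      (by rw [dotProduct_neg, h.dotProduct_mulVec_eq_zero hy, neg_zero])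
    refine Finset.eq_univ_of_forall fun i => mem_argmax.2 fun j => le_of_eq ?_
    have hi := this i (h.pos_left i).ne'
    have hj := this j (h.pos_left j).ne'
    rw [Pi.neg_apply, neg_eq_zero] at hi hj
    rw [hi, hj]
  · intro hu
    rw [← h.dotProduct_mulVec_eq_zero hy]
    exact (dotProduct_eq_of_mem_stdSimplex h.mem_stdSimplex
      fun i _ => eq_topValue (hu ▸ Finset.mem_univ i)).symm

theorem IsEqualizing.mulVec_eq_zero (h : IsEqualizing M pbar qbar c) {y : Fin n → ℝ}
    (hy : ∑ j, y j = 0) (h0 : topValue (M *ᵥ y) = 0) : M *ᵥ y = 0 := by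
  ext i
  have hi : i ∈ argmax (M *ᵥ y) := (h.topValue_eq_zero_iff hy).1 h0 ▸ Finset.mem_univ i
  rw [eq_topValue hi, h0]
  rfl

theorem IsEqualizing.gap_eq_zero_iff (h : IsEqualizing M pbar qbar c)
    {x : (Fin m → ℝ) × (Fin n → ℝ)} (hx : x ∈ tangentSpace m n) :
    gap M x = 0 ↔ topValue (M *ᵥ x.2) = 0 ∧ topValue ((-Mᵀ) *ᵥ x.1) = 0 :=
  add_eq_zero_iff_of_nonneg (h.topValue_nonneg hx.2) (h.swap.topValue_nonneg hx.1)

theorem IsEqualizing.argmax_mulVec_sub (h : IsEqualizing M pbar qbar c) (q : Fin n → ℝ) :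
    argmax (M *ᵥ (q - qbar)) = argmax (M *ᵥ q) := by
  rw [← argmax_add_const (M *ᵥ (q - qbar)) c, mulVec_sub, h.mulVec_right]
  congr 1
  ext i
  simp

theorem IsEqualizing.sub_mem_tangentSpace_iff (h : IsEqualizing M pbar qbar c)
    {z : (Fin m → ℝ) × (Fin n → ℝ)} :
    z - (pbar, qbar) ∈ tangentSpace m n ↔ z ∈ phaseSpace m n := by
  rw [mem_tangentSpace]
  simp [phaseSpace, mem_hyperplane, Finset.sum_sub_distrib, h.sum_left, h.sum_right, sub_eq_zero]

theorem IsEqualizing.isIndifferent_iff (h : IsEqualizing M pbar qbar c)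
    {z : (Fin m → ℝ) × (Fin n → ℝ)} (hz : z ∈ phaseSpace m n) :
    IsIndifferent M z ↔ gap M (z - (pbar, qbar)) = 0 := by
  have hx := h.sub_mem_tangentSpace_iff.2 hz
  rw [h.gap_eq_zero_iff hx, h.topValue_eq_zero_iff hx.2, h.swap.topValue_eq_zero_iff hx.1,
    Prod.fst_sub, Prod.snd_sub, h.argmax_mulVec_sub, h.swap.argmax_mulVec_sub, IsIndifferent,
    brP_eq_bestResp, brQ_eq_bestResp, bestResp_eq_stdSimplex_iff, bestResp_eq_stdSimplex_iff]

theorem IsEqualizing.mem_vectorField_iff (h : IsEqualizing M pbar qbar c)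
    (z v : (Fin m → ℝ) × (Fin n → ℝ)) :
    v ∈ vectorField M X Y α pbar qbar z ↔
      v + (z - (pbar, qbar)) ∈ velocities M X Y α pbar qbar (z - (pbar, qbar)) := by
  have e1 : bestResp (M *ᵥ (z - (pbar, qbar)).2) = brP M z.2 :=
    bestResp_congr (h.argmax_mulVec_sub z.2)
  have e2 : bestResp ((-Mᵀ) *ᵥ (z - (pbar, qbar)).1) = brQ M z.1 := by
    rw [brQ_eq_bestResp]
    exact bestResp_congr (h.swap.argmax_mulVec_sub z.1)
  have key : ∀ u w, v = (X *ᵥ u + α • pbar - z.1, Y *ᵥ w + α • qbar - z.2) ↔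
      (X *ᵥ u + (α - 1) • pbar, Y *ᵥ w + (α - 1) • qbar) = v + (z - (pbar, qbar)) := by
    intro u w
    have : (X *ᵥ u + (α - 1) • pbar, Y *ᵥ w + (α - 1) • qbar) - (z - (pbar, qbar)) =
        (X *ᵥ u + α • pbar - z.1, Y *ᵥ w + α • qbar - z.2) := by
      ext <;> simp <;> ring
    rw [← this, eq_sub_iff_add_eq]
    exact eq_comm
  rw [velocities, e1, e2]
  constructor
  · rintro ⟨u, hu, w, hw, e⟩
    exact ⟨(u, w), ⟨hu, hw⟩, (key u w).1 e⟩
  · rintro ⟨⟨u, w⟩, ⟨hu, hw⟩, e⟩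
    exact ⟨u, hu, w, hw, (key u w).2 e⟩

theorem velocities_smul (x : (Fin m → ℝ) × (Fin n → ℝ)) {r : ℝ} (hr : 0 < r) :
    velocities M X Y α pbar qbar (r • x) = velocities M X Y α pbar qbar x := by
  rw [velocities, velocities, Prod.smul_fst, Prod.smul_snd, mulVec_smul, mulVec_smul,
    bestResp_congr (argmax_smul hr _), bestResp_congr (argmax_smul hr _)]

theorem gap_smul (x : (Fin m → ℝ) × (Fin n → ℝ)) {r : ℝ} (hr : 0 < r) :
    gap M (r • x) = r * gap M x := by
  rw [gap, gap, Prod.smul_fst, Prod.smul_snd, mulVec_smul, mulVec_smul, topValue_smul hr.le,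
    topValue_smul hr.le, mul_add]

theorem exists_isLocallyMaximal_velocities [Nonempty (Fin m)] [Nonempty (Fin n)] :
    ∃ K, IsLocallyMaximal (velocities M X Y α pbar qbar) K := by
  let f : (Fin m → ℝ) × (Fin n → ℝ) →ᵃ[ℝ] (Fin m → ℝ) × (Fin n → ℝ) :=
    (X.mulVecLin.prodMap Y.mulVecLin).toAffineMap +
      AffineMap.const ℝ _ ((α - 1) • pbar, (α - 1) • qbar)
  have hf : (f : _ → _) = fun s => (X *ᵥ s.1 + (α - 1) • pbar, Y *ᵥ s.2 + (α - 1) • qbar) := rfl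
  have hfc : Continuous f := f.continuous_of_finiteDimensional
  obtain ⟨K, hK⟩ := ((((isCompact_stdSimplex ℝ (Fin m)).prod
    (isCompact_stdSimplex ℝ (Fin n))).image hfc).isBounded).subset_closedBall 0
  refine ⟨K, fun x => ?_, fun x => ?_, fun x => ?_, fun x => ?_, fun x => ?_⟩
  · exact ((bestResp_nonempty _).prod (bestResp_nonempty _)).image _
  · rw [velocities, ← hf]
    exact ((convex_bestResp _).prod (convex_bestResp _)).affine_image f
  · rw [velocities, ← hf]
    exact (((isCompact_bestResp _).prod (isCompact_bestResp _)).image hfc).isClosed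
  · refine (image_mono (prod_mono (fun u hu => hu.1) fun w hw => hw.1)).trans hK
  · have c1 : Continuous fun y : (Fin m → ℝ) × (Fin n → ℝ) => M *ᵥ y.2 :=
      continuous_const.matrix_mulVec continuous_snd
    have c2 : Continuous fun y : (Fin m → ℝ) × (Fin n → ℝ) => (-Mᵀ) *ᵥ y.1 :=
      continuous_const.matrix_mulVec continuous_fst
    filter_upwards [c1.continuousAt.eventually (eventually_argmax_subset (M *ᵥ x.2)),
      c2.continuousAt.eventually (eventually_argmax_subset ((-Mᵀ) *ᵥ x.1))] with y h1 h2
    exact image_mono (prod_mono (bestResp_subset_of_argmax_subset h1)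
      (bestResp_subset_of_argmax_subset h2))

theorem IsEqualizing.mulVec_add_smul_velocity (h : IsEqualizing M pbar qbar c)
    (y w : Fin n → ℝ) (r : ℝ) (i : Fin m) :
    (M *ᵥ (y + r • (Y *ᵥ w + (α - 1) • qbar))) i =
      (M *ᵥ y) i + r * (((M * Y) *ᵥ w) i + (α - 1) * c) := by
  rw [mulVec_add, mulVec_smul, mulVec_add, mulVec_smul, h.mulVec_right, mulVec_mulVec]
  simp only [Pi.add_apply, Pi.smul_apply, smul_eq_mul]

theorem neg_transpose_mul (hcomm : M * Y = Xᵀ * M) : (-Mᵀ) * X = -(M * Y)ᵀ := by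
  rw [hcomm, transpose_mul, transpose_transpose, Matrix.neg_mul]

theorem dotProduct_add_mul_add (u : Fin m → ℝ) (hu : u ∈ stdSimplex ℝ (Fin m)) (a b : Fin m → ℝ)
    (r d : ℝ) : u ⬝ᵥ (fun i => a i + r * (b i + d)) = u ⬝ᵥ a + r * (u ⬝ᵥ b + d) := by
  have h := hu.2
  simp only [dotProduct, mul_add, Finset.sum_add_distrib, Finset.mul_sum]
  rw [← Finset.sum_mul, h]
  simp only [mul_left_comm, one_mul]

/-- The strategies `u` and `w` that were optimal at `x` bound the new maxima from below. Their
first-order terms are `r u M Y w` and its negative, by `M Y = Xᵀ M`, and cancel for either sign of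
`r`. -/
theorem IsEqualizing.gap_le (h : IsEqualizing M pbar qbar c) (hcomm : M * Y = Xᵀ * M)
    (x : (Fin m → ℝ) × (Fin n → ℝ)) :
    ∀ g ∈ velocities M X Y α pbar qbar x, ∀ r : ℝ, gap M x ≤ gap M (x + r • g) := by
  rintro _ ⟨⟨u, w⟩, ⟨hu, hw⟩, rfl⟩ r
  dsimp only at hu hw ⊢
  have e1 : M *ᵥ (x.2 + r • (Y *ᵥ w + (α - 1) • qbar)) = fun i =>
      (M *ᵥ x.2) i + r * (((M * Y) *ᵥ w) i + (α - 1) * c) :=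
    funext fun i => h.mulVec_add_smul_velocity _ _ _ _
  have e2 : (-Mᵀ) *ᵥ (x.1 + r • (X *ᵥ u + (α - 1) • pbar)) = fun j =>
      ((-Mᵀ) *ᵥ x.1) j + r * ((-(u ᵥ* (M * Y))) j + (α - 1) * -c) := funext fun j => by
    rw [h.swap.mulVec_add_smul_velocity, neg_transpose_mul hcomm, neg_transpose_mulVec (M * Y)]
  have h1 := dotProduct_le_of_mem_stdSimplex
    (a := M *ᵥ (x.2 + r • (Y *ᵥ w + (α - 1) • qbar))) hu.1 fun i _ => le_topValue _ i
  have h2 := dotProduct_le_of_mem_stdSimplex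
    (a := (-Mᵀ) *ᵥ (x.1 + r • (X *ᵥ u + (α - 1) • pbar))) hw.1 fun i _ => le_topValue _ i
  rw [e1, dotProduct_add_mul_add u hu.1, dotProduct_eq_topValue hu, ← e1] at h1
  rw [e2, dotProduct_add_mul_add w hw.1, dotProduct_eq_topValue hw, dotProduct_neg,
    dotProduct_comm w, ← dotProduct_mulVec, ← e2] at h2
  have : gap M (x + r • (X *ᵥ u + (α - 1) • pbar, Y *ᵥ w + (α - 1) • qbar)) =
      topValue (M *ᵥ (x.2 + r • (Y *ᵥ w + (α - 1) • qbar))) +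
        topValue ((-Mᵀ) *ᵥ (x.1 + r • (X *ᵥ u + (α - 1) • pbar))) := rfl
  rw [this, gap]
  linarith

/-- Velocities along which the gap does not change come from equilibria of the local game. -/
theorem IsEqualizing.mul_mulVec_le (h : IsEqualizing M pbar qbar c) (hcomm : M * Y = Xᵀ * M)
    {x : (Fin m → ℝ) × (Fin n → ℝ)} {u : Fin m → ℝ} {w : Fin n → ℝ} {r : ℝ}
    (hgap : gap M (x + r • (X *ᵥ u + (α - 1) • pbar, Y *ᵥ w + (α - 1) • qbar)) = gap M x)
    {i : Fin m} (hi : i ∈ argmax (M *ᵥ x.2)) {j : Fin n} (hj : j ∈ argmax ((-Mᵀ) *ᵥ x.1)) :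
    r * ((M * Y) *ᵥ w) i ≤ r * (u ᵥ* (M * Y)) j := by
  -- Testing the new maxima at `i` and `j` bounds the new gap from below by the old one plus `r ((L
  -- w) i - (u L) j)` with `L = M Y`; equality of the gaps makes this term nonpositive.
  have h1 := le_topValue (M *ᵥ (x.2 + r • (Y *ᵥ w + (α - 1) • qbar))) i
  have h2 := le_topValue ((-Mᵀ) *ᵥ (x.1 + r • (X *ᵥ u + (α - 1) • pbar))) j
  rw [h.mulVec_add_smul_velocity, eq_topValue hi] at h1
  rw [h.swap.mulVec_add_smul_velocity, eq_topValue hj, neg_transpose_mul hcomm,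
    neg_transpose_mulVec (M * Y), Pi.neg_apply] at h2
  have : gap M (x + r • (X *ᵥ u + (α - 1) • pbar, Y *ᵥ w + (α - 1) • qbar)) =
      topValue (M *ᵥ (x.2 + r • (Y *ᵥ w + (α - 1) • qbar))) +
        topValue ((-Mᵀ) *ᵥ (x.1 + r • (X *ᵥ u + (α - 1) • pbar))) := rfl
  rw [this, gap] at hgap
  linarith

end Game

/-! ### Uniqueness of gap-preserving velocities -/

section Uniqueness

variable {m n : ℕ} {M : Matrix (Fin m) (Fin n) ℝ} {X : Matrix (Fin m) (Fin m) ℝ}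
  {Y : Matrix (Fin n) (Fin n) ℝ} {α c : ℝ} {pbar : Fin m → ℝ} {qbar : Fin n → ℝ}

/-- Equilibria of a zero-sum game with payoffs `A` on the supports of the strategies involved are
interchangeable and have a common value. -/
theorem exists_common_value {A : Matrix (Fin m) (Fin n) ℝ} {I : Finset (Fin m)}
    {J : Finset (Fin n)} {u₁ u₂ : Fin m → ℝ} {w₁ w₂ : Fin n → ℝ} (hu₁ : u₁ ∈ face I)
    (hu₂ : u₂ ∈ face I) (hw₁ : w₁ ∈ face J) (hw₂ : w₂ ∈ face J)
    (h₁ : ∀ i ∈ I, ∀ j ∈ J, (A *ᵥ w₁) i ≤ (u₁ ᵥ* A) j)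
    (h₂ : ∀ i ∈ I, ∀ j ∈ J, (A *ᵥ w₂) i ≤ (u₂ ᵥ* A) j) :
    ∃ v, (∀ i ∈ I, (A *ᵥ w₁) i ≤ v) ∧ (∀ i ∈ I, (A *ᵥ w₂) i ≤ v) ∧
      (∀ j ∈ J, v ≤ (u₁ ᵥ* A) j) ∧ (∀ j ∈ J, v ≤ (u₂ ᵥ* A) j) := by
  rw [mem_face_iff] at hu₁ hu₂ hw₁ hw₂
  have hi : ∀ {u u' : Fin m → ℝ} {w w' : Fin n → ℝ},
      (u ∈ stdSimplex ℝ (Fin m) ∧ ∀ i, u i ≠ 0 → i ∈ I) →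
      (w ∈ stdSimplex ℝ (Fin n) ∧ ∀ j, w j ≠ 0 → j ∈ J) →
      (∀ i ∈ I, ∀ j ∈ J, (A *ᵥ w') i ≤ (u' ᵥ* A) j) →
      (∀ i ∈ I, (A *ᵥ w') i ≤ u' ⬝ᵥ (A *ᵥ w)) ∧ (∀ j ∈ J, u ⬝ᵥ (A *ᵥ w') ≤ (u' ᵥ* A) j) := by
    intro u u' w w' hu hw h
    constructor
    · intro i hi
      rw [dotProduct_mulVec, dotProduct_comm]
      exact le_dotProduct_of_mem_stdSimplex hw.1 fun j hj => h i hi j (hw.2 j hj)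
    · intro j hj
      exact dotProduct_le_of_mem_stdSimplex hu.1 fun i hi => h i (hu.2 i hi) j hj
  have h11 := hi hu₁ hw₁ h₁
  have h12 := hi hu₁ hw₂ h₁
  have h21 := hi hu₂ hw₁ h₂
  have h22 := hi hu₂ hw₂ h₂
  -- The four mixed payoffs satisfy a cyclic chain of inequalities, `11 ≤ 12 ≤ 22 ≤ 21 ≤ 11`, so
  -- they coincide.
  have a1 : u₁ ⬝ᵥ (A *ᵥ w₁) ≤ u₁ ⬝ᵥ (A *ᵥ w₂) :=
    dotProduct_le_of_mem_stdSimplex hu₁.1 fun i hi => h12.1 i (hu₁.2 i hi)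
  have a2 : u₂ ⬝ᵥ (A *ᵥ w₂) ≤ u₂ ⬝ᵥ (A *ᵥ w₁) :=
    dotProduct_le_of_mem_stdSimplex hu₂.1 fun i hi => h21.1 i (hu₂.2 i hi)
  have a3 : u₁ ⬝ᵥ (A *ᵥ w₂) ≤ u₂ ⬝ᵥ (A *ᵥ w₂) :=
    dotProduct_le_of_mem_stdSimplex hu₁.1 fun i hi => h22.1 i (hu₁.2 i hi)
  have a4 : u₂ ⬝ᵥ (A *ᵥ w₁) ≤ u₁ ⬝ᵥ (A *ᵥ w₁) :=
    dotProduct_le_of_mem_stdSimplex hu₂.1 fun i hi => h11.1 i (hu₂.2 i hi)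
  have e : u₁ ⬝ᵥ (A *ᵥ w₁) = u₂ ⬝ᵥ (A *ᵥ w₂) := by linarith
  exact ⟨_, h11.1, fun i hi => e ▸ h22.1 i hi, h11.2, fun j hj => e ▸ h22.2 j hj⟩

/-- In an equilibrium the payoffs of all strategies in the supports equal the value. -/
theorem payoffs_eq_value {A : Matrix (Fin m) (Fin n) ℝ} {I : Finset (Fin m)} {J : Finset (Fin n)}
    {u : Fin m → ℝ} {w : Fin n → ℝ} {v : ℝ} (hu : u ∈ face I) (hw : w ∈ face J)
    (hwv : ∀ i ∈ I, (A *ᵥ w) i ≤ v) (huv : ∀ j ∈ J, v ≤ (u ᵥ* A) j) :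
    (∀ i, u i ≠ 0 → (A *ᵥ w) i = v) ∧ ∀ j, w j ≠ 0 → (u ᵥ* A) j = v := by
  rw [mem_face_iff] at hu hw
  have h1 : u ⬝ᵥ (A *ᵥ w) ≤ v :=
    dotProduct_le_of_mem_stdSimplex hu.1 fun i hi => hwv i (hu.2 i hi)
  have h2 : v ≤ w ⬝ᵥ (u ᵥ* A) :=
    le_dotProduct_of_mem_stdSimplex hw.1 fun j hj => huv j (hw.2 j hj)
  have h3 : u ⬝ᵥ (A *ᵥ w) = w ⬝ᵥ (u ᵥ* A) := by rw [dotProduct_mulVec, dotProduct_comm]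
  constructor
  · intro i hi
    have := eq_of_dotProduct_le (a := -(A *ᵥ w)) (v := -v) hu.1
      (fun i hi => neg_le_neg (hwv i (hu.2 i hi))) (by rw [dotProduct_neg]; linarith) i hi
    exact neg_inj.1 this
  · exact eq_of_dotProduct_le hw.1 (fun j hj => huv j (hw.2 j hj)) (by linarith)

theorem midpoint_mem_face {k : ℕ} {I : Finset (Fin k)} {u₁ u₂ : Fin k → ℝ} (h₁ : u₁ ∈ face I)
    (h₂ : u₂ ∈ face I) : (1 / 2 : ℝ) • u₁ + (1 / 2 : ℝ) • u₂ ∈ face I :=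
  convex_convexHull ℝ _ h₁ h₂ (by norm_num) (by norm_num) (by norm_num)

/-- Both velocities come from equilibria of one local game. If these differ for either player,
`eq_or_full_support` makes both players indifferent, and the gap is zero. -/
theorem IsEqualizing.velocity_unique (h : IsEqualizing M pbar qbar c) (hcomm : M * Y = Xᵀ * M)
    (hlevelX : ∀ p ∈ stdSimplex ℝ (Fin m), X *ᵥ p + α • pbar ∈ hyperplane m)
    (hlevelY : ∀ q ∈ stdSimplex ℝ (Fin n), Y *ᵥ q + α • qbar ∈ hyperplane n)
    (htrans1 : FirstTransversality M) (htrans3 : ThirdTransversality M X Y α pbar qbar)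
    {x : (Fin m → ℝ) × (Fin n → ℝ)} (hx : x ∈ tangentSpace m n) (hgap : gap M x ≠ 0)
    {r : ℝ} (hr : r ≠ 0) {g₁ g₂ : (Fin m → ℝ) × (Fin n → ℝ)}
    (hg₁ : g₁ ∈ velocities M X Y α pbar qbar x) (hg₂ : g₂ ∈ velocities M X Y α pbar qbar x)
    (h₁ : gap M (x + r • g₁) = gap M x) (h₂ : gap M (x + r • g₂) = gap M x) : g₁ = g₂ := by
  obtain ⟨⟨u₁, w₁⟩, ⟨hu₁, hw₁⟩, rfl⟩ := hg₁
  obtain ⟨⟨u₂, w₂⟩, ⟨hu₂, hw₂⟩, rfl⟩ := hg₂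
  dsimp only at hu₁ hw₁ hu₂ hw₂ h₁ h₂ ⊢
  set I := argmax (M *ᵥ x.2) with hI
  set J := argmax ((-Mᵀ) *ᵥ x.1) with hJ
  have hfI : bestResp (M *ᵥ x.2) = face I := bestResp_eq_face_iff.2 rfl
  have hfJ : bestResp ((-Mᵀ) *ᵥ x.1) = face J := bestResp_eq_face_iff.2 rfl
  have fu₁ := hfI ▸ hu₁
  have fu₂ := hfI ▸ hu₂
  have fw₁ := hfJ ▸ hw₁
  have fw₂ := hfJ ▸ hw₂
  set L := M * Y with hL
  have eqL : ∀ (w : Fin n → ℝ) i, ((r • L) *ᵥ w) i = r * (L *ᵥ w) i := fun w i => by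
    rw [smul_mulVec]
    rfl
  have eqR : ∀ (u : Fin m → ℝ) j, (u ᵥ* (r • L)) j = r * (u ᵥ* L) j := fun u j => by
    rw [vecMul_smul]
    rfl
  obtain ⟨v, hv₁, hv₂, hv₁', hv₂'⟩ := exists_common_value (A := r • L) fu₁ fu₂ fw₁ fw₂
    (fun i hi j hj => by rw [eqL, eqR]; exact h.mul_mulVec_le hcomm h₁ hi hj)
    (fun i hi j hj => by rw [eqL, eqR]; exact h.mul_mulVec_le hcomm h₂ hi hj)
  -- Equilibria are interchangeable and convex, so the midpoint strategies are a common equilibrium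
  -- opponent of both given ones.
  set u := (1 / 2 : ℝ) • u₁ + (1 / 2 : ℝ) • u₂ with hu
  set w := (1 / 2 : ℝ) • w₁ + (1 / 2 : ℝ) • w₂ with hw
  have fu : u ∈ face I := midpoint_mem_face fu₁ fu₂
  have fw : w ∈ face J := midpoint_mem_face fw₁ fw₂
  have hvw : ∀ i ∈ I, ((r • L) *ᵥ w) i ≤ v := fun i hi => by
    have a1 := hv₁ i hi
    have a2 := hv₂ i hi
    rw [hw, mulVec_add, mulVec_smul, mulVec_smul]
    simp only [Pi.add_apply, Pi.smul_apply, smul_eq_mul]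
    linarith
  have hvu : ∀ j ∈ J, v ≤ (u ᵥ* (r • L)) j := fun j hj => by
    have a1 := hv₁' j hj
    have a2 := hv₂' j hj
    rw [hu, add_vecMul, smul_vecMul, smul_vecMul]
    simp only [Pi.add_apply, Pi.smul_apply, smul_eq_mul]
    linarith
  have pay₁ := payoffs_eq_value fu₁ fw hvw hv₁'
  have pay₂ := payoffs_eq_value fu₂ fw hvw hv₂'
  have pay₁' := payoffs_eq_value fu fw₁ hv₁ hvu
  have pay₂' := payoffs_eq_value fu fw₂ hv₂ hvu
  simp only [eqL, eqR] at hvw hvu pay₁ pay₂ pay₁' pay₂'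
  have su := (mem_face_iff.1 fu).1
  have sw := (mem_face_iff.1 fw).1
  have hu12 : u₁ = u₂ ∨ ((∀ j, w j ≠ 0) ∧ x.2 = 0) :=
    eq_or_full_support htrans1 h.pos_right h.sum_right h.mulVec_right hlevelY
      (fun T J hT hJ => (htrans3 J T hJ hT).2) hx.2 hr sw hvw hu₁ hu₂ pay₁.1 pay₂.1 pay₁.2 pay₂.2
  have eL' : (-Mᵀ) * X = -Lᵀ := neg_transpose_mul hcomm
  have eA : ∀ j, r * (((-Mᵀ) * X) *ᵥ u) j = -(r * (u ᵥ* L) j) := fun j => by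
    rw [eL', neg_transpose_mulVec, Pi.neg_apply, mul_neg]
  have eB : ∀ (w : Fin n → ℝ) i, r * (w ᵥ* ((-Mᵀ) * X)) i = -(r * (L *ᵥ w) i) := fun w i => by
    rw [eL', vecMul_neg, vecMul_transpose, Pi.neg_apply, mul_neg]
  -- The same argument with the players exchanged: the local payoffs become `-Lᵀ` and the value
  -- `-v`.
  have hw12 : w₁ = w₂ ∨ ((∀ i, u i ≠ 0) ∧ x.1 = 0) := by
    refine eq_or_full_support htrans1.neg_transpose h.pos_left h.sum_left h.mulVec_left hlevelX
      (fun T I hT hI => ?_) hx.1 hr su (v := -v) (fun j hj => ?_) hw₁ hw₂ (fun j hj => ?_)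
      (fun j hj => ?_) (fun i hi => ?_) (fun i hi => ?_)
    · rw [← indiffP_eq]
      exact (htrans3 T I hT hI).1
    · rw [eA]
      exact neg_le_neg (hvu j hj)
    · rw [eA, pay₁'.2 j hj]
    · rw [eA, pay₂'.2 j hj]
    · rw [eB, pay₁'.1 i hi]
    · rw [eB, pay₂'.1 i hi]
  -- Full support of `w` makes all of the second player's strategies optimal, and `x.2 = 0` does so
  -- for the first player.
  have hu' : u₁ = u₂ := hu12.resolve_right fun ⟨hfull, h0⟩ => hgap <| by
    refine (h.gap_eq_zero_iff hx).2 ⟨(h.topValue_eq_zero_iff hx.2).2 ?_,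
      (h.swap.topValue_eq_zero_iff hx.1).2 ?_⟩
    · refine Finset.eq_univ_of_forall fun i => mem_argmax.2 fun j => ?_
      simp [h0]
    · exact Finset.eq_univ_of_forall fun j => (mem_face_iff.1 fw).2 j (hfull j)
  have hw' : w₁ = w₂ := hw12.resolve_right fun ⟨hfull, h0⟩ => hgap <| by
    refine (h.gap_eq_zero_iff hx).2 ⟨(h.topValue_eq_zero_iff hx.2).2 ?_,
      (h.swap.topValue_eq_zero_iff hx.1).2 ?_⟩
    · exact Finset.eq_univ_of_forall fun i => (mem_face_iff.1 fu).2 i (hfull i)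
    · refine Finset.eq_univ_of_forall fun i => mem_argmax.2 fun j => ?_
      simp [h0]
  rw [hu', hw']

theorem velocities_subset_tangentSpace (h : IsEqualizing M pbar qbar c)
    (hlevelX : ∀ p ∈ stdSimplex ℝ (Fin m), X *ᵥ p + α • pbar ∈ hyperplane m)
    (hlevelY : ∀ q ∈ stdSimplex ℝ (Fin n), Y *ᵥ q + α • qbar ∈ hyperplane n)
    (x : (Fin m → ℝ) × (Fin n → ℝ)) :
    velocities M X Y α pbar qbar x ⊆ tangentSpace m n := by
  rintro _ ⟨⟨u, w⟩, ⟨hu, hw⟩, rfl⟩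
  have h1 := hlevelX u hu.1
  have h2 := hlevelY w hw.1
  rw [mem_hyperplane] at h1 h2
  refine mem_tangentSpace.2 ⟨?_, ?_⟩
  · rw [← sub_eq_zero.2 (h1.trans h.sum_left.symm), ← Finset.sum_sub_distrib]
    refine Finset.sum_congr rfl fun i _ => ?_
    simp only [Pi.add_apply, Pi.smul_apply, smul_eq_mul]
    ring
  · rw [← sub_eq_zero.2 (h2.trans h.sum_right.symm), ← Finset.sum_sub_distrib]
    refine Finset.sum_congr rfl fun i _ => ?_
    simp only [Pi.add_apply, Pi.smul_apply, smul_eq_mul]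
    ring

theorem continuous_gap [Nonempty (Fin m)] [Nonempty (Fin n)] : Continuous (gap M) :=
  (continuous_topValue.comp (continuous_const.matrix_mulVec continuous_snd)).add
    (continuous_topValue.comp (continuous_const.matrix_mulVec continuous_fst))

theorem IsEqualizing.eq_zero_of_gap_eq_zero (h : IsEqualizing M pbar qbar c) (hmn : m = n)
    (htrans1 : FirstTransversality M) {x : (Fin m → ℝ) × (Fin n → ℝ)}
    (hx : x ∈ tangentSpace m n) (hgap : gap M x = 0) : x = 0 := by
  subst hmn
  rw [h.gap_eq_zero_iff hx] at hgap
  have h1 := h.mulVec_eq_zero hx.2 hgap.1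
  have h2 := h.swap.mulVec_eq_zero hx.1 hgap.2
  refine Prod.ext ?_ ?_
  · exact htrans1.neg_transpose.eq_zero_of_mulVec_eq_const (Finset.card_fin m) h.sum_left
      h.mulVec_left hx.1 (κ := 0) fun i _ => congrFun h2 i
  · exact htrans1.eq_zero_of_mulVec_eq_const (Finset.card_fin m) h.sum_right
      h.mulVec_right hx.2 (κ := 0) fun i _ => congrFun h1 i

end Uniqueness

end ZeroSumGame

/-! ### The main theorem: square games, and general games off the indifferent set -/

theorem mainTheorem3 {m n : ℕ} (M : Matrix (Fin m) (Fin n) ℝ)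
    (pbar : Fin m → ℝ) (qbar : Fin n → ℝ)
    (hNash : ZeroSumGame.IsCompletelyMixedNash M pbar qbar)
    (α : ℝ) (X : Matrix (Fin m) (Fin m) ℝ) (Y : Matrix (Fin n) (Fin n) ℝ)
    (hcomm : M * Y = Xᵀ * M)
    (hlevelX : ∀ p ∈ stdSimplex ℝ (Fin m), X *ᵥ p + α • pbar ∈ ZeroSumGame.hyperplane m)
    (hlevelY : ∀ q ∈ stdSimplex ℝ (Fin n), Y *ᵥ q + α • qbar ∈ ZeroSumGame.hyperplane n)
    (htrans1 : ZeroSumGame.FirstTransversality M)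
    (htrans3 : ZeroSumGame.ThirdTransversality M X Y α pbar qbar) :
    (m = n →
      (∀ z ∈ ZeroSumGame.phaseSpace m n, z ≠ (pbar, qbar) →
        ZeroSumGame.HasUniqueSolution (ZeroSumGame.vectorField M X Y α pbar qbar) z) ∧
      ZeroSumGame.GeneratesFlow (ZeroSumGame.vectorField M X Y α pbar qbar)
        (ZeroSumGame.phaseSpace m n)) ∧
    ((∀ z ∈ ZeroSumGame.phaseSpace m n, ¬ ZeroSumGame.IsIndifferent M z →
        ZeroSumGame.HasUniqueSolution (ZeroSumGame.vectorField M X Y α pbar qbar) z) ∧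
      ZeroSumGame.GeneratesFlow (ZeroSumGame.vectorField M X Y α pbar qbar)
        {z ∈ ZeroSumGame.phaseSpace m n | ¬ ZeroSumGame.IsIndifferent M z}) := by
  obtain ⟨c, h⟩ := hNash.isEqualizing
  have : Nonempty (Fin m) := ZeroSumGame.nonempty_of_mem_stdSimplex h.mem_stdSimplex
  have : Nonempty (Fin n) := ZeroSumGame.nonempty_of_mem_stdSimplex h.swap.mem_stdSimplex
  obtain ⟨K, hG⟩ := ZeroSumGame.exists_isLocallyMaximal_velocities (M := M) (X := X) (Y := Y)
    (α := α) (pbar := pbar) (qbar := qbar)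
  have hsub := ZeroSumGame.velocities_subset_tangentSpace h hlevelX hlevelY
  constructor
  · intro hmn
    have hh : ZeroSumGame.Conserves (ZeroSumGame.velocities M X Y α pbar qbar)
        (ZeroSumGame.tangentSpace m n) (ZeroSumGame.gap M) univ := by
      refine ⟨ZeroSumGame.continuous_gap, hsub, h.gap_le hcomm, ?_⟩
      intro x hx _ r hr g₁ hg₁ g₂ hg₂ e₁ e₂
      -- For `m = n` the gap vanishes only at `x = 0`, so at gap zero both secants end at the
      -- origin. Every level of the gap is thus admissible, and the flow extends over the
      -- equilibrium.
      by_cases h0 : ZeroSumGame.gap M x = 0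
      · have hz : ∀ g ∈ ZeroSumGame.velocities M X Y α pbar qbar x,
            ZeroSumGame.gap M (x + r • g) = ZeroSumGame.gap M x → x + r • g = 0 := fun g hg e =>
          h.eq_zero_of_gap_eq_zero hmn htrans1
            (add_mem hx (Submodule.smul_mem _ r (hsub x hg))) (e.trans h0)
        exact smul_right_injective _ hr
          (add_left_cancel ((hz g₁ hg₁ e₁).trans (hz g₂ hg₂ e₂).symm))
      · exact h.velocity_unique hcomm hlevelX hlevelY htrans1 htrans3 hx h0 hr hg₁ hg₂ e₁ e₂
    obtain ⟨h1, h2⟩ := ZeroSumGame.hasUniqueSolution_and_generatesFlow hG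
      (fun x r hr => ZeroSumGame.velocities_smul x hr) h.mem_vectorField_iff hh
      (fun _ _ _ _ => mem_univ _)
    refine ⟨fun z hz _ => h1 z (h.sub_mem_tangentSpace_iff.2 hz) (mem_univ _), ?_⟩
    convert h2 using 1
    ext z
    simp [h.sub_mem_tangentSpace_iff]
  · have hh : ZeroSumGame.Conserves (ZeroSumGame.velocities M X Y α pbar qbar)
        (ZeroSumGame.tangentSpace m n) (ZeroSumGame.gap M) {0}ᶜ :=
      ⟨ZeroSumGame.continuous_gap, hsub, h.gap_le hcomm,
        fun x hx h0 r hr g₁ hg₁ g₂ hg₂ e₁ e₂ =>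
          h.velocity_unique hcomm hlevelX hlevelY htrans1 htrans3 hx h0 hr hg₁ hg₂ e₁ e₂⟩
    obtain ⟨h1, h2⟩ := ZeroSumGame.hasUniqueSolution_and_generatesFlow hG
      (fun x r hr => ZeroSumGame.velocities_smul x hr) h.mem_vectorField_iff hh
      -- Scaling by `r > 0` multiplies the gap by `r`, so the complement of the zero level is
      -- invariant.
      (fun x r hr hx => by
        rw [ZeroSumGame.gap_smul x hr]
        exact mul_ne_zero hr.ne' hx)
    refine ⟨fun z hz hN => h1 z (h.sub_mem_tangentSpace_iff.2 hz)
      (fun h0 => hN ((h.isIndifferent_iff hz).2 h0)), ?_⟩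
    convert h2 using 1
    ext z
    simp only [mem_ofPred_eq, h.sub_mem_tangentSpace_iff, mem_compl_iff, mem_singleton_iff]
    exact and_congr_right fun hz => not_congr (h.isIndifferent_iff hz)
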